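/- **Conventions.** Fix sets $\mathsf{Var}$ of variables and $\mathsf{Act}$ of actions, and let $\mathsf{Ord}_\infty=\mathsf{Ord}\cup\{\infty\}$. *Countdown formulas* are given by $$\phi ::= x \mid \top \mid \bot \mid \phi_1\vee\phi_2 \mid \phi_1\wedge\phi_2 \mid \langle\tau\rangle\phi \mid [\tau]\phi \mid \mu^\alpha_i\overline{x}.\overline{\phi} \mid \nu^\alpha_i\overline{x}.\overline{\phi}$$ with $\overline x=(x_1,\dots,x_n)\in\mathsf{Var}^n$, $\overline\phi=(\phi_1,\dots,\phi_n)$, $1\le i\le n$, $\alpha\in\mathsf{Ord}_\infty$. A model is a set $M$ with relations $\stackrel{\tau}{\to}\,\subseteq M\times M$ for $\tau\in\mathsf{Act}$. For a valuation $\mathsf{val}:\mathsf{Var}\to\mathcal P(M)$, the set $[\![\phi]\!]^{\mathsf{val}}\subseteq M$ is defined as usual for variables, Boolean connectives and modalities, and $[\![\eta^\alpha_i\overline x.\overline\phi]\!]^{\mathsf{val}}=\pi_i(F^\alpha_\eta)$ for $F(\overline H)=([\![\phi_j]\!]^{\mathsf{val}[\overline x\mapsto\overline H]})_{j}$, where $F^\infty_\mu,F^\infty_\nu$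 are the least and greatest fixpoints of $F$, and $F^\alpha_\mu=\bigvee_{\beta<\alpha}F(F^\beta_\mu)$, $F^\alpha_\nu=\bigwedge_{\beta<\alpha}F(F^\beta_\nu)$ for ordinals $\alpha$. (If a variable is repeated in $\overline x$, its last occurrence counts.) A *countdown game* has positions $V=V_\exists\sqcup V_\forall$, edges $E\subseteq V\times V$, a finite linear order $\mathcal R=\mathcal R_\exists\sqcup\mathcal R_\forall$ of ranks, a set $\mathcal D\subseteq\mathcal R$ of nonstandard ranks, a map $\mathsf{rank}:V\to\mathcal R$, and initial counters $\mathsf{ctr}_I:\mathcal D\to\mathsf{Ord}$. From a positional configuration $\langle v,\mathsf{ctr}\rangle$ the owner of $v$ chooses an edge $(v,w)\in E$, and play moves to the countdown configuration $[w,\mathsf{ctr}]$. From $[v,\mathsf{ctr}]$ with $r=\mathsf{rank}(v)$ the owner of $r$ moves to some $\langle v,\mathsf{ctr}'\rangle$ with $\mathsf{ctr}'(r')=\mathsf{ctr}_I(r')$ for $r'<r$, $\mathsf{ctr}'(r)<\mathsf{ctr}(r)$ if $r\in\mathcal D$, and $\mathsf{ctr}'(r')=\mathsf{ctr}(r')$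 for $r'>r$. A player who has to move and cannot loses; an infinite play is lost by the owner of the greatest rank occurring infinitely often. Strategies may depend on the whole history. A *countdown automaton* $\mathcal A$ has a finite set of states $Q=Q_\exists\sqcup Q_\forall$, an initial $q_I\in Q\sqcup\mathsf{Var}$, a transition function $\delta:Q\to\mathcal P(Q\sqcup\mathsf{Var})\sqcup(\mathsf{Act}\times(Q\sqcup\mathsf{Var}))$, ranks $\mathsf{rank}:Q\to\mathcal R$, and $\mathsf{ctr}_I:\mathcal D\to\mathsf{Ord}$. Its *semantic game* has positions $M\times(Q\sqcup\mathsf{Var})$ and edges $(m,q)\to(m,z)$ for $z\in\delta(q)$ if $\delta(q)$ is a set, and $(m,q)\to(n,p)$ for $m\stackrel{\tau}{\to}n$ if $\delta(q)=(\tau,p)$. Owner and rank of $(m,q)$ are those of $q$. Positions $(m,x)$, $x\in\mathsf{Var}$, have no outgoing edges and belong to $\forall$dam if $m\in\mathsf{val}(x)$ and to $\exists$ve otherwise; their ranks are arbitrary, except that any such rank that is nonstandard has an infinite initial counter value. $[\![\mathcal A]\!]^{\mathsf{val}}$ is the set of points $m$ such that $\exists$ve wins this game from the positional configuration $\langle(m,q_I),\mathsf{ctr}_I\rangle$.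 The *automaton $\mathcal A_\phi$* has as states all occurrences of subformulas of $\phi$ except the free occurrences of variables (which stand for elements of $\mathsf{Var}$), and $q_I=\phi$. $\exists$ve owns $\vee,\langle\tau\rangle,\bot$; $\forall$dam owns $\wedge,[\tau],\top$; ownership of the other states is arbitrary. Transitions: $\delta(\theta_1\vee\theta_2)=\delta(\theta_1\wedge\theta_2)=\{\theta_1,\theta_2\}$; $\delta(\top)=\delta(\bot)=\emptyset$; $\delta(\langle\tau\rangle\theta)=\delta([\tau]\theta)=(\tau,\theta)$; $\delta(\eta^\alpha_i\overline x.\overline\theta)=\{\theta_i\}$; and $\delta(x)=\{\theta_j\}$ for a bound occurrence of $x$, where the innermost operator binding it is $\eta^\alpha_i\overline x.\overline\theta$ with $x=x_j$. The lowest rank $0$ is standard; all subformulas that are not components of a tuple under a fixpoint operator have rank $0$. The ranks of the components are arbitrary subject to: a component properly contained in another has strictly smaller rank; all components of the tuple of an operator $\eta^\alpha_i\overline x.\overline\theta$ have the same rank $r$, owned by $\exists$ve if $\eta=\mu$ and by $\forall$dam if $\eta=\nu$; and $r$ is standard if $\alpha=\infty$, and otherwise nonstandard with $\mathsf{ctr}_I(r)=\alpha$.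 **Theorem (Adequacy).** Let $\phi$ be a countdown formula such that, whenever a component of the tuple under an operator $\mu^\alpha$ or $\nu^\alpha$ with $\alpha\in\mathsf{Ord}$ is just a free variable of $\phi$, the ordinal $\alpha$ is infinite (for instance, any formula whose countdown operators use only nonzero limit ordinals). Then for every admissible choice of the ranks and ownerships above, every model and every valuation $\mathsf{val}$, $$[\![\phi]\!]^{\mathsf{val}}=[\![\mathcal A_\phi]\!]^{\mathsf{val}}.$$ Equivalently, for every point $m$, $\exists$ve wins the semantic game of $\mathcal A_\phi$ from $\langle(m,\phi),\mathsf{ctr}_I\rangle$ if and only if $m\in[\![\phi]\!]^{\mathsf{val}}$. -/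

import Mathlib

/-!
# The countdown mu-calculus, countdown games and countdown automata

`Ord` is `Ordinal.{u}`, `Ord` with the extra element `∞` is `WithTop Ordinal.{u}`.
-/

universe u

namespace CountdownMu

/-- The two players. -/
inductive Player where
  | eve
  | adam

/-! ## Formulas and their semantics -/

/-- The two kinds of fixpoint operators. -/
inductive FixKind where
  | mu
  | nu

/-- Ranks of least fixpoint operators belong to Eve, those of greatest ones to Adam. -/
def FixKind.owner : FixKind → Player
  | .mu => .eve
  | .nu => .adam

/-- Formulas of the (vectorial) countdown mu-calculus. `fix η α i x θ` is the formula
`η^α_i (x_1, …, x_n). (θ_1, …, θ_n)`; the index `i : Fin n` forces `1 ≤ n`. -/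
inductive Formula (Act Var : Type*) where
  | var (x : Var)
  | top
  | bot
  | or (φ ψ : Formula Act Var)
  | and (φ ψ : Formula Act Var)
  | dia (τ : Act) (φ : Formula Act Var)
  | box (τ : Act) (φ : Formula Act Var)
  | fix (η : FixKind) (α : WithTop Ordinal.{u}) {n : ℕ} (i : Fin n) (x : Fin n → Var)
      (θ : Fin n → Formula Act Var)

/-- For a monotone `F` on a complete lattice: `F^∞_η` is the least / greatest fixpoint, and for an
ordinal `α`, `F^α_μ = ⨆ β < α, F (F^β_μ)` and `F^α_ν = ⨅ β < α, F (F^β_ν)`. -/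
noncomputable def approx {A : Type u} [CompleteLattice A] :
    FixKind → WithTop Ordinal.{u} → (A →o A) → A
  | .mu, none, F => OrderHom.lfp F
  | .mu, some α, F => OrdinalApprox.lfpApprox F ⊥ α
  | .nu, none, F => OrderHom.gfp F
  | .nu, some α, F => OrdinalApprox.gfpApprox F ⊤ α

theorem approx_mono {A : Type u} [CompleteLattice A] (η : FixKind) (α : WithTop Ordinal.{u}) :
    Monotone (approx (A := A) η α) := by
  intro F G h
  rcases η with _ | _ <;> rcases α with _ | α
  · exact OrderHom.lfp.monotone h
  · exact OrdinalApprox.lfpApprox_mono_left h ⊥ α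
  · exact OrderHom.gfp.monotone h
  · exact OrdinalApprox.gfpApprox_mono_left h ⊤ α

open Classical in
/-- The index under which the tuple `x` binds the variable `v`, if any. If `v` is repeated in `x`
then its last occurrence counts. -/
noncomputable def lastIndex {Var : Type*} {n : ℕ} (x : Fin n → Var) (v : Var) : Option (Fin n) :=
  (List.finRange n).reverse.find? (fun j => decide (x j = v))

/-- The valuation `val[x_1 ↦ H_1, …, x_n ↦ H_n]`. -/
noncomputable def update {Var M : Type*} {n : ℕ} (val : Var → Set M) (x : Fin n → Var)
    (H : Fin n → Set M) : Var → Set M :=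
  fun v => match lastIndex x v with
    | some j => H j
    | none => val v

theorem update_mono {Var M : Type*} {n : ℕ} (x : Fin n → Var) {val val' : Var → Set M}
    {H H' : Fin n → Set M} (h : val ≤ val') (hH : H ≤ H') :
    update val x H ≤ update val' x H' := by
  intro v
  unfold update
  split
  · exact hH _
  · exact h _

/-- The meaning of a diamond formula, where `f` is the meaning of the formula under the modality. -/
def diaSem {Var M : Type*} (E : M → M → Prop) (f : (Var → Set M) →o Set M) :
    (Var → Set M) →o Set M where
  toFun val := {m | ∃ n, E m n ∧ n ∈ f val}
  monotone' _ _ h := by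
    rintro m ⟨n, hn, hf⟩
    exact ⟨n, hn, f.monotone h hf⟩

/-- The meaning of a box formula, where `f` is the meaning of the formula under the modality. -/
def boxSem {Var M : Type*} (E : M → M → Prop) (f : (Var → Set M) →o Set M) :
    (Var → Set M) →o Set M where
  toFun val := {m | ∀ n, E m n → n ∈ f val}
  monotone' _ _ h := fun _ hm n hn => f.monotone h (hm n hn)

/-- The map `F (H_1, …, H_n) = (f_1 (val'), …, f_n (val'))`, where
`val' = val[x_1 ↦ H_1, …, x_n ↦ H_n]`. -/
noncomputable def tupleMap {Var M : Type*} {n : ℕ} (x : Fin n → Var)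
    (f : Fin n → ((Var → Set M) →o Set M)) (val : Var → Set M) :
    (Fin n → Set M) →o (Fin n → Set M) where
  toFun H j := f j (update val x H)
  monotone' _ _ h j := (f j).monotone (update_mono x le_rfl h)

/-- The meaning of `η^α_i (x_1, …, x_n). (θ_1, …, θ_n)`, where `f j` is the meaning of `θ_j`. -/
noncomputable def fixSem {Var : Type*} {M : Type u} {n : ℕ} (η : FixKind)
    (α : WithTop Ordinal.{u}) (i : Fin n) (x : Fin n → Var)
    (f : Fin n → ((Var → Set M) →o Set M)) : (Var → Set M) →o Set M where
  toFun val := approx η α (tupleMap x f val) i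
  monotone' val val' h := by
    have hF : tupleMap x f val ≤ tupleMap x f val' :=
      fun _ j => (f j).monotone (update_mono x h le_rfl)
    exact approx_mono η α hF i

/-- The semantics of a formula in the model with set of points `M` and transition relations
`step τ`, as a monotone function of the valuation. -/
noncomputable def Formula.sem {Act Var : Type*} {M : Type u} (step : Act → M → M → Prop) :
    Formula.{u} Act Var → (Var → Set M) →o Set M
  | .var x => ⟨fun val => val x, fun _ _ h => h x⟩
  | .top => ⟨fun _ => Set.univ, fun _ _ _ => le_rfl⟩
  | .bot => ⟨fun _ => ∅, fun _ _ _ => le_rfl⟩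
  | .or φ ψ => φ.sem step ⊔ ψ.sem step
  | .and φ ψ => φ.sem step ⊓ ψ.sem step
  | .dia τ φ => diaSem (step τ) (φ.sem step)
  | .box τ φ => boxSem (step τ) (φ.sem step)
  | .fix η α i x θ => fixSem η α i x (fun j => (θ j).sem step)

/-! ## Countdown games -/

/-- A countdown game with set of positions `V` and ranks `R`. -/
structure CountdownGame (V R : Type*) [LinearOrder R] [Finite R] where
  /-- the owner of a position -/
  owner : V → Player
  /-- the edge relation -/
  edge : V → V → Prop
  /-- the owner of a rank -/
  rankOwner : R → Player
  /-- the set of nonstandard ranks -/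
  nonstd : Set R
  /-- the rank of a position -/
  rank : V → R
  /-- the initial counter valuation -/
  ctrI : nonstd → Ordinal.{u}

namespace CountdownGame

variable {V R : Type*} [LinearOrder R] [Finite R] (G : CountdownGame.{u} V R)

/-- Counter valuations. -/
abbrev Ctr : Type _ := G.nonstd → Ordinal.{u}

/-- Positional and countdown configurations. -/
inductive Config where
  | positional (v : V) (ctr : G.Ctr)
  | countdown (v : V) (ctr : G.Ctr)

variable {G}

/-- The position of a configuration. -/
def Config.position : G.Config → V
  | .positional v _ => v
  | .countdown v _ => v

/-- The player who moves in a configuration. -/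
def Config.turn : G.Config → Player
  | .positional v _ => G.owner v
  | .countdown v _ => G.rankOwner (G.rank v)

/-- The legal moves between configurations. -/
inductive Move : G.Config → G.Config → Prop
  | positional (v w : V) (ctr : G.Ctr) (h : G.edge v w) :
      Move (.positional v ctr) (.countdown w ctr)
  | countdown (v : V) (ctr ctr' : G.Ctr)
      (reset : ∀ r : G.nonstd, r < G.rank v → ctr' r = G.ctrI r)
      (decrement : ∀ r : G.nonstd, r = G.rank v → ctr' r < ctr r)
      (keep : ∀ r : G.nonstd, G.rank v < r → ctr' r = ctr r) :
      Move (.countdown v ctr) (.positional v ctr')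

/-- The finite play consisting of the first `n + 1` configurations of `π`. -/
def history (π : ℕ → G.Config) (n : ℕ) : List G.Config := (List.range (n + 1)).map π

/-- The first `n + 1` configurations of `π` form a play that is consistent with the strategy `σ`
of player `P`. (A strategy picks a next configuration after each finite play; only its values on
plays ending in a configuration where `P` moves are ever used, see also `IsWinning`.) -/
def ConsistentUpTo (P : Player) (σ : List G.Config → G.Config) (π : ℕ → G.Config) (n : ℕ) : Prop :=
  ∀ k < n, Move (π k) (π (k + 1)) ∧ ((π k).turn = P → π (k + 1) = σ (history π k))

/-- `P` wins the infinite play `π`: the greatest rank that appears infinitely often in it does not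
belong to `P`. -/
def WinsInfinite (P : Player) (π : ℕ → G.Config) : Prop :=
  ∃ r, IsGreatest {s | ∃ᶠ n in Filter.atTop, G.rank (π n).position = s} r ∧ G.rankOwner r ≠ P

/-- The strategy `σ` of `P` is winning from `γ`: after every consistent finite play in which `P`
has to move, it yields a legal move (so that `P` is never stuck), and all infinite consistent plays
are won by `P`. -/
def IsWinning (P : Player) (γ : G.Config) (σ : List G.Config → G.Config) : Prop :=
  ∀ π : ℕ → G.Config, π 0 = γ →
    (∀ n, ConsistentUpTo P σ π n → (π n).turn = P → Move (π n) (σ (history π n))) ∧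
    ((∀ n, ConsistentUpTo P σ π n) → WinsInfinite P π)

/-- `P` has a winning strategy in the game initialized in `γ`. -/
def Wins (P : Player) (γ : G.Config) : Prop := ∃ σ, IsWinning P γ σ

end CountdownGame

/-! ## Countdown automata -/

/-- A countdown automaton with states `Q`, ranks `R` and free variables in `Var`. The initial state
may also be a free variable (needed for the automaton of a formula that is just a variable). -/
structure CountdownAutomaton (Act Var Q R : Type*) [Finite Q] [LinearOrder R] [Finite R] where
  /-- the owner of a state -/
  owner : Q → Player
  /-- the initial state -/
  init : Q ⊕ Var
  /-- the transition function: on the left the epsilon-transitions, on the right the modal ones -/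
  δ : Q → Set (Q ⊕ Var) ⊕ (Act × (Q ⊕ Var))
  /-- the owner of a rank -/
  rankOwner : R → Player
  /-- the set of nonstandard ranks -/
  nonstd : Set R
  /-- the rank of a state -/
  rank : Q → R
  /-- the initial counter valuation -/
  ctrI : nonstd → Ordinal.{u}

namespace CountdownAutomaton

variable {Act Var Q R M : Type*} [Finite Q] [LinearOrder R] [Finite R]

open Classical in
/-- The semantic game of an automaton in a model under a valuation. The ranks `varRank` of the
positions `(m, x)` with `x` a variable are a parameter. -/
noncomputable def game (𝒜 : CountdownAutomaton.{u} Act Var Q R) (step : Act → M → M → Prop)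
    (val : Var → Set M) (varRank : M → Var → R) : CountdownGame.{u} (M × (Q ⊕ Var)) R where
  owner
    | (_, .inl q) => 𝒜.owner q
    | (m, .inr x) => if m ∈ val x then .adam else .eve
  edge
    | (m, .inl q), (n, z) =>
      match 𝒜.δ q with
      | .inl S => n = m ∧ z ∈ S
      | .inr (τ, p) => step τ m n ∧ z = p
    | (_, .inr _), _ => False
  rankOwner := 𝒜.rankOwner
  nonstd := 𝒜.nonstd
  rank
    | (_, .inl q) => 𝒜.rank q
    | (m, .inr x) => varRank m x
  ctrI := 𝒜.ctrI

/-- The language of an automaton in a model under a valuation: the points `m` such that Eve wins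
the semantic game from the positional configuration at `(m, init)` with the initial counters. -/
def language (𝒜 : CountdownAutomaton.{u} Act Var Q R) (step : Act → M → M → Prop)
    (val : Var → Set M) (varRank : M → Var → R) : Set M :=
  {m | CountdownGame.Wins (G := 𝒜.game step val varRank) .eve (.positional (m, 𝒜.init) 𝒜.ctrI)}

end CountdownAutomaton

/-! ## From formulas to automata -/

namespace Formula

variable {Act Var : Type*}

/-- The immediate subformulas of a formula, numbered from `0`. -/
def child : Formula.{u} Act Var → ℕ → Option (Formula.{u} Act Var)
  | .or φ _, 0 => some φ
  | .or _ ψ, 1 => some ψ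
  | .and φ _, 0 => some φ
  | .and _ ψ, 1 => some ψ
  | .dia _ φ, 0 => some φ
  | .box _ φ, 0 => some φ
  | .fix (n := n) _ _ _ _ θ, k => if h : k < n then some (θ ⟨k, h⟩) else none
  | _, _ => none

/-- The subformula of `φ` at the end of a path that starts at the root of `φ`. -/
def sub : Formula.{u} Act Var → List ℕ → Option (Formula.{u} Act Var)
  | φ, [] => some φ
  | φ, k :: p => (φ.child k).bind (fun ψ => ψ.sub p)

/-- Occurrences of subformulas of `φ`, that is, paths in its syntactic tree. -/
abbrev Occ (φ : Formula.{u} Act Var) : Type := {p : List ℕ // (φ.sub p).isSome}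

/-- The index under which the topmost operator of a formula binds `v`, if it does. -/
noncomputable def bindIndex : Formula.{u} Act Var → Var → Option ℕ
  | .fix _ _ _ x _, v => (lastIndex x v).map Fin.val
  | _, _ => none

/-- For an occurrence of the variable `v` at the path `p`: if the innermost fixpoint operator above
it that binds `v` is `η^α_i (x_1, …, x_n). (θ_1, …, θ_n)` with `v = x_j`, this is the path of
`θ_j`; it is `none` if there is no such operator. -/
noncomputable def target : Formula.{u} Act Var → List ℕ → Var → Option (List ℕ)
  | _, [], _ => none
  | φ, k :: p, v =>
    match φ.child k with
    | none => none
    | some ψ =>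
      match ψ.target p v with
      | some q => some (k :: q)
      | none => (φ.bindIndex v).map (fun j => [j])

/-- The variable at the path `p`, if there is a free occurrence of a variable of `φ` there. -/
noncomputable def freeVar (φ : Formula.{u} Act Var) (p : List ℕ) : Option Var :=
  match φ.sub p with
  | some (.var v) =>
    match φ.target p v with
    | none => some v
    | some _ => none
  | _ => none

/-- The states of the automaton of `φ`: the occurrences of subformulas of `φ` other than the free
occurrences of variables. -/
abbrev State (φ : Formula.{u} Act Var) : Type :=
  {p : List ℕ // (φ.sub p).isSome ∧ φ.freeVar p = none}

/-- The state or free variable at an occurrence of a subformula. -/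
noncomputable def locate (φ : Formula.{u} Act Var) (p : List ℕ) (h : (φ.sub p).isSome) :
    φ.State ⊕ Var :=
  match hp : φ.freeVar p with
  | some v => .inr v
  | none => .inl ⟨p, h, hp⟩

theorem sub_append (φ : Formula.{u} Act Var) (p q : List ℕ) :
    φ.sub (p ++ q) = (φ.sub p).bind (fun ψ => ψ.sub q) := by
  induction p generalizing φ with
  | nil => rfl
  | cons k p ih =>
    simp only [List.cons_append, sub, Option.bind_assoc]
    congr 1
    funext ψ
    exact ih ψ

theorem sub_child {φ ψ : Formula.{u} Act Var} {p : List ℕ} (h : φ.sub p = some ψ) {k : ℕ}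
    (hk : (ψ.child k).isSome) : (φ.sub (p ++ [k])).isSome := by
  obtain ⟨χ, hχ⟩ := Option.isSome_iff_exists.1 hk
  simp [sub_append, h, sub, hχ]

theorem child_bindIndex {φ : Formula.{u} Act Var} {v : Var} {j : ℕ} (h : φ.bindIndex v = some j) :
    (φ.child j).isSome := by
  cases φ <;> simp only [bindIndex, reduceCtorEq, Option.map_eq_some_iff] at h
  obtain ⟨a, -, rfl⟩ := h
  simp [child]

theorem target_isSome {φ : Formula.{u} Act Var} {p t : List ℕ} {v : Var}
    (h : φ.target p v = some t) : (φ.sub t).isSome := by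
  induction p generalizing φ t with
  | nil => simp [target] at h
  | cons k p ih =>
    rw [target] at h
    split at h
    · simp at h
    · rename_i ψ hψ
      split at h
      · rename_i q hq
        cases h
        simpa [sub, hψ] using ih hq
      · simp only [Option.map_eq_some_iff] at h
        obtain ⟨j, hj, rfl⟩ := h
        obtain ⟨χ, hχ⟩ := Option.isSome_iff_exists.1 (child_bindIndex hj)
        simp [sub, hχ]

theorem finite_occ (φ : Formula.{u} Act Var) : {p : List ℕ | (φ.sub p).isSome}.Finite := by
  have key : ∀ (φ : Formula.{u} Act Var) (N : ℕ),
      (∀ k ψ, φ.child k = some ψ → k < N ∧ {p : List ℕ | (ψ.sub p).isSome}.Finite) →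
      {p : List ℕ | (φ.sub p).isSome}.Finite := by
    intro φ N h
    refine ((Set.finite_singleton ([] : List ℕ)).union
      ((Set.finite_lt_nat N).biUnion (t := fun k =>
        (List.cons k) '' {p | ((φ.child k).bind (fun ψ => ψ.sub p)).isSome}) ?_)).subset ?_
    · intro k _
      refine Set.Finite.image _ ?_
      cases hk : φ.child k with
      | none => simp
      | some ψ => simpa using (h k ψ hk).2
    · rintro (_ | ⟨k, p⟩) hp
      · simp
      · right
        simp only [Set.mem_ofPred_eq, sub] at hp
        cases hk : φ.child k with
        | none => simp [hk] at hp
        | some ψ =>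
          simp only [Set.mem_iUnion]
          exact ⟨k, (h k ψ hk).1, p, hp, rfl⟩
  induction φ with
  | var x => exact key _ 0 (by simp [child])
  | top => exact key _ 0 (by simp [child])
  | bot => exact key _ 0 (by simp [child])
  | or φ ψ h1 h2 =>
    refine key _ 2 ?_
    rintro (_ | _ | k) χ hχ <;> simp [child] at hχ <;> subst hχ
    · simp [h1]
    · simp [h2]
  | and φ ψ h1 h2 =>
    refine key _ 2 ?_
    rintro (_ | _ | k) χ hχ <;> simp [child] at hχ <;> subst hχ
    · simp [h1]
    · simp [h2]
  | dia τ φ h1 =>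
    refine key _ 1 ?_
    rintro (_ | k) χ hχ <;> simp [child] at hχ
    subst hχ
    simp [h1]
  | box τ φ h1 =>
    refine key _ 1 ?_
    rintro (_ | k) χ hχ <;> simp [child] at hχ
    subst hχ
    simp [h1]
  | @fix η α n i x θ h =>
    refine key _ n ?_
    intro k χ hχ
    simp only [child] at hχ
    split at hχ
    · rename_i hk
      cases hχ
      exact ⟨hk, h _⟩
    · cases hχ

instance (φ : Formula.{u} Act Var) : Finite φ.Occ := (finite_occ φ).to_subtype

instance (φ : Formula.{u} Act Var) : Finite φ.State :=
  ((finite_occ φ).subset (fun _ h => h.1)).to_subtype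

/-- The occurrence `p` is an immediate subformula (a component of the tuple) of a fixpoint operator
`η^α` that occurs at the path `w`. -/
def IsComponent (φ : Formula.{u} Act Var) (w : List ℕ) (η : FixKind) (α : WithTop Ordinal.{u})
    (p : φ.Occ) : Prop :=
  ∃ (n : ℕ) (i : Fin n) (x : Fin n → Var) (θ : Fin n → Formula.{u} Act Var) (j : Fin n),
    φ.sub w = some (.fix η α i x θ) ∧ p.1 = w ++ [j.1]

/-- The choices that the construction of the automaton of `φ` leaves open: the ranks and initial
counter values, and the irrelevant ownerships. -/
structure Ranking (φ : Formula.{u} Act Var) (R : Type*) [LinearOrder R] [Finite R]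
    [OrderBot R] where
  /-- the owner of a rank -/
  rankOwner : R → Player
  /-- the set of nonstandard ranks -/
  nonstd : Set R
  /-- the initial counter valuation -/
  ctrI : nonstd → Ordinal.{u}
  /-- the rank of a subformula -/
  rank : φ.Occ → R
  /-- the ownership of fixpoint and countdown subformulas and of variables; it is arbitrary, and
  the values at other subformulas are not used -/
  otherOwner : φ.Occ → Player
  /-- the lowest rank is standard -/
  bot_standard : ⊥ ∉ nonstd
  /-- all subformulas but the immediate subformulas of fixpoint operators have the lowest rank -/
  rank_eq_bot : ∀ p, (∀ w η α, ¬ φ.IsComponent w η α p) → rank p = ⊥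
  /-- immediate subformulas of fixpoint operators have strictly smaller ranks than those that
  properly contain them -/
  rank_lt : ∀ p p' w w' η η' α α', φ.IsComponent w η α p → φ.IsComponent w' η' α' p' →
    p'.1 <+: p.1 → p'.1 ≠ p.1 → rank p < rank p'
  /-- the components of one tuple have the same rank -/
  rank_eq : ∀ p p' w η α, φ.IsComponent w η α p → φ.IsComponent w η α p' → rank p = rank p'
  /-- ranks of least fixpoint operators belong to Eve, those of greatest ones to Adam -/
  rank_owner : ∀ p w η α, φ.IsComponent w η α p → rankOwner (rank p) = η.owner
  /-- classical fixpoint operators have standard ranks -/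
  rank_standard : ∀ p w η, φ.IsComponent w η ⊤ p → rank p ∉ nonstd
  /-- countdown operators have nonstandard ranks and determine the initial counter values -/
  rank_nonstd : ∀ p w η (α : Ordinal.{u}), φ.IsComponent w η α p →
    ∃ h : rank p ∈ nonstd, ctrI ⟨rank p, h⟩ = α

/-- Ranks and initial counter values as required exist for every formula. -/
theorem exists_ranking (φ : Formula.{u} Act Var) :
    ∃ (R : Type) (_ : LinearOrder R) (_ : Finite R) (_ : OrderBot R), Nonempty (φ.Ranking R) := by
  classical
  let key : φ.Occ → ℕᵒᵈ ×ₗ List ℕ := fun p => toLex (OrderDual.toDual p.1.length, p.1)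
  let R₀ : Type := Set.range key
  have hfin : Finite R₀ := Set.finite_range key
  let inc : φ.Occ → WithBot R₀ := fun p => ((⟨key p, p, rfl⟩ : R₀) : WithBot R₀)
  have occ_of : ∀ w η α p, φ.IsComponent w η α p → (φ.sub w).isSome := by
    rintro w η α p ⟨n, i, x, θ, j, h, -⟩
    simp [h]
  have uniq : ∀ w w' η η' α α' (p : φ.Occ), φ.IsComponent w η α p → φ.IsComponent w' η' α' p →
      w = w' ∧ η = η' ∧ α = α' := by
    rintro w w' η η' α α' p ⟨n, i, x, θ, j, h, hp⟩ ⟨n', i', x', θ', j', h', hp'⟩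
    rw [hp] at hp'
    obtain ⟨rfl, -⟩ := List.append_inj' hp' rfl
    rw [h] at h'
    simp only [Option.some.injEq, Formula.fix.injEq] at h'
    exact ⟨rfl, h'.1, h'.2.1⟩
  let ord : WithBot R₀ → Option (FixKind × WithTop Ordinal.{u}) := fun r =>
    match r with
    | none => none
    | some w => match φ.sub (ofLex w.1).2 with
      | some (.fix η α _ _ _) => some (η, α)
      | _ => none
  let rank : φ.Occ → WithBot R₀ := fun p =>
    if h : ∃ w η α, φ.IsComponent w η α p then
      inc ⟨h.choose, by obtain ⟨η, α, h'⟩ := h.choose_spec; exact occ_of _ _ _ _ h'⟩ else ⊥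
  have rank_comp : ∀ w η α p (h : φ.IsComponent w η α p),
      rank p = inc ⟨w, occ_of _ _ _ _ h⟩ := by
    intro w η α p h
    have hex : ∃ w η α, φ.IsComponent w η α p := ⟨w, η, α, h⟩
    obtain ⟨η', α', h'⟩ := hex.choose_spec
    simp only [rank, dif_pos hex]
    congr 1
    apply Subtype.ext
    exact (uniq _ _ _ _ _ _ _ h' h).1
  have ord_comp : ∀ w η α p (h : φ.IsComponent w η α p), ord (rank p) = some (η, α) := by
    intro w η α p h
    rw [rank_comp w η α p h]
    obtain ⟨n, i, x, θ, j, h, -⟩ := h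
    simp only [ord]
    change (match φ.sub w with
      | some (.fix η α _ _ _) => some (η, α)
      | _ => none) = _
    rw [h]
  refine ⟨WithBot R₀, inferInstance, inferInstanceAs (Finite (Option R₀)), inferInstance, ⟨{
    rankOwner := fun r => match ord r with
      | some (η, _) => η.owner
      | none => .eve
    nonstd := {r | ∃ η, ∃ α : Ordinal.{u}, ord r = some (η, (α : WithTop Ordinal.{u}))}
    ctrI := fun r => r.2.choose_spec.choose
    rank := rank
    otherOwner := fun _ => .eve
    bot_standard := ?_
    rank_eq_bot := ?_
    rank_lt := ?_
    rank_eq := ?_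
    rank_owner := ?_
    rank_standard := ?_
    rank_nonstd := ?_ }⟩⟩
  · rintro ⟨η, α, h⟩
    cases h
  · intro p h
    have : ¬ ∃ w η α, φ.IsComponent w η α p := by
      rintro ⟨w, η, α, h'⟩
      exact h _ _ _ h'
    simp only [rank, dif_neg this]
  · intro p p' w w' η η' α α' h h' hpre hne
    rw [rank_comp _ _ _ _ h, rank_comp _ _ _ _ h']
    refine WithBot.coe_lt_coe.2 ?_
    change key _ < key _
    rw [Prod.Lex.toLex_lt_toLex]
    left
    change w'.length < w.length
    obtain ⟨n, i, x, θ, j, -, hp⟩ := h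
    obtain ⟨n', i', x', θ', j', -, hp'⟩ := h'
    have h1 : p'.1.length < p.1.length := by
      rcases hpre.length_le.lt_or_eq with h1 | h1
      · exact h1
      · exact absurd (hpre.eq_of_length h1) hne
    rw [hp, hp'] at h1
    simpa using h1
  · intro p p' w η α h h'
    rw [rank_comp _ _ _ _ h, rank_comp _ _ _ _ h']
  · intro p w η α h
    simp only [ord_comp _ _ _ _ h]
  · rintro p w η h ⟨η', α, h'⟩
    rw [ord_comp _ _ _ _ h] at h'
    simp at h'
  · intro p w η α h
    have hm : rank p ∈ {r | ∃ η, ∃ α : Ordinal.{u}, ord r = some (η, (α : WithTop Ordinal.{u}))} :=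
      ⟨η, α, ord_comp _ _ _ _ h⟩
    refine ⟨hm, ?_⟩
    have h2 := hm.choose_spec.choose_spec
    have h3 := (ord_comp _ _ _ _ h).symm.trans h2
    simp only [Option.some.injEq, Prod.mk.injEq] at h3
    exact (WithTop.coe_injective h3.2).symm

/-- The owners of the states of the automaton of `φ`. -/
def stateOwner (φ : Formula.{u} Act Var) (otherOwner : φ.Occ → Player) (q : φ.State) : Player :=
  match φ.sub q.1 with
  | some (.or _ _) => .eve
  | some (.dia _ _) => .eve
  | some .bot => .eve
  | some (.and _ _) => .adam
  | some (.box _ _) => .adam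
  | some .top => .adam
  | _ => otherOwner ⟨q.1, q.2.1⟩

/-- The transition function of the automaton of `φ`. -/
noncomputable def delta (φ : Formula.{u} Act Var) (q : φ.State) :
    Set (φ.State ⊕ Var) ⊕ (Act × (φ.State ⊕ Var)) :=
  match h : φ.sub q.1 with
  | some (.var v) => .inl {z | ∃ t, ∃ ht : φ.target q.1 v = some t,
      z = φ.locate t (target_isSome ht)}
  | some .top => .inl ∅
  | some .bot => .inl ∅
  | some (.or _ _) => .inl {φ.locate (q.1 ++ [0]) (sub_child h rfl),
      φ.locate (q.1 ++ [1]) (sub_child h rfl)}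
  | some (.and _ _) => .inl {φ.locate (q.1 ++ [0]) (sub_child h rfl),
      φ.locate (q.1 ++ [1]) (sub_child h rfl)}
  | some (.dia τ _) => .inr (τ, φ.locate (q.1 ++ [0]) (sub_child h rfl))
  | some (.box τ _) => .inr (τ, φ.locate (q.1 ++ [0]) (sub_child h rfl))
  | some (.fix _ _ i _ _) => .inl {φ.locate (q.1 ++ [i.1]) (sub_child h (by simp [child]))}
  | none => .inl ∅

/-- The automaton of `φ`, for given choices of ranks and of irrelevant ownerships. -/
noncomputable def automaton (φ : Formula.{u} Act Var) {R : Type*} [LinearOrder R] [Finite R]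
    [OrderBot R] (ρ : φ.Ranking R) : CountdownAutomaton.{u} Act Var φ.State R where
  owner := φ.stateOwner ρ.otherOwner
  init := φ.locate [] rfl
  δ := φ.delta
  rankOwner := ρ.rankOwner
  nonstd := ρ.nonstd
  rank q := ρ.rank ⟨q.1, q.2.1⟩
  ctrI := ρ.ctrI

/-- Whenever a component of the tuple under a countdown operator `η^α` (`α` an ordinal) is just a
free variable of `φ`, the ordinal `α` is infinite. -/
def FreeComponentsInfinite (φ : Formula.{u} Act Var) : Prop :=
  ∀ (p : φ.Occ) (w : List ℕ) (η : FixKind) (α : Ordinal.{u}),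
    φ.IsComponent w η α p → (φ.freeVar p.1).isSome → Ordinal.omega0 ≤ α

end Formula

end CountdownMu

open CountdownMu

/-!
# Adequacy of countdown automata for the countdown mu-calculus

A player `P` wins the semantic game as soon as the claim of `P` about the formula is true: that it
holds at the given point (Eve) or fails there (Adam). Both directions of the theorem follow, since
the two players cannot both win.

During a play, `P` has in mind an ordinal for every rank, and interprets the variables bound by an
operator by the approximant for the ordinal of its rank (`Formula.valAt`, `Ranking.index`).
`P` maintains that, under this interpretation, the claim about the current subformula is true
(`Ranking.Invariant`). Boolean connectives and modalities preserve this by definition. An operator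
that is entered from above has an ordinal that amounts to its own index
(`approx_index_of_fresh`), because lower ranks have been reset. When a component of a tuple is
left, the equation `F^α = ⨆ β < α, F (F^β)` or its dual lets the owner of the rank choose a smaller
ordinal: for a nonstandard rank this choice is the decrement of the counter, for a standard rank of
`P` it is a choice that only `P` keeps track of, starting from an ordinal at which all fixpoints
have been reached, and a standard operator of the opponent is interpreted by its fixpoint, which
needs no ordinal.

In an infinite play, components of tuples recur (`frequently_atComponent`). The greatest recurring
rank is standard, since its counter would decrease forever otherwise, and it does not belong to
`P`, since the ordinal of `P` for it would decrease forever otherwise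
(`winsInfinite_of_memoryStep`).

The positions of free variables need care, as they may have the rank of an operator, and as a
component that is a free variable is visited without a decrement of the counter of its tuple. At
ranks with an infinite initial value, the ordinals therefore differ from the counters by one step in
favour of the opponent (`Ranking.Link`). This costs nothing, because `1 + α = α` for infinite `α`.
Where the initial value is finite, neither of the two situations occurs, by assumption.
-/

namespace CountdownMu

/-! ### Strategies with memory -/

/-- A sequence in a well-founded order that is eventually non-increasing does not decrease
infinitely often. -/
theorem not_frequently_lt {α : Type*} [Preorder α] [WellFoundedLT α] {f : ℕ → α}
    (hle : ∀ᶠ n in Filter.atTop, f (n + 1) ≤ f n) :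
    ¬ ∃ᶠ n in Filter.atTop, f (n + 1) < f n := by
  intro hlt
  obtain ⟨N, hN⟩ := Filter.eventually_atTop.1 hle
  obtain ⟨a, ⟨k, hk, rfl⟩, hmin⟩ := WellFounded.has_min (wellFounded_lt (α := α))
    (f '' Set.Ici N) ⟨f N, N, Set.self_mem_Ici, rfl⟩
  obtain ⟨n, hn, h⟩ := Filter.frequently_atTop.1 hlt k
  have hanti : ∀ n ≥ k, f n ≤ f k := by
    intro n hn
    induction n, hn using Nat.le_induction with
    | base => exact le_rfl
    | succ n hn ih => exact (hN n (le_trans hk hn)).trans ih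
  exact hmin _ ⟨n + 1, le_trans hk (hn.trans n.le_succ), rfl⟩ (h.trans_le (hanti n hn))

namespace CountdownGame

variable {V R : Type*} [LinearOrder R] [Finite R] {G : CountdownGame.{u} V R}

theorem history_zero (π : ℕ → G.Config) : history π 0 = [π 0] := rfl

theorem history_succ (π : ℕ → G.Config) (n : ℕ) :
    history π (n + 1) = history π n ++ [π (n + 1)] := by
  simp [history, List.range_succ (n := n + 1)]

/-- The two players do not both have a winning strategy: the play in which both follow theirs
would be won by both. -/
theorem not_wins_adam_of_wins_eve {γ : G.Config} (he : Wins .eve γ) : ¬ Wins .adam γ := by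
  rintro ⟨τ, hτ⟩
  obtain ⟨σ, hσ⟩ := he
  let next : List G.Config → G.Config → G.Config := fun h c =>
    match c.turn with
    | .eve => σ h
    | .adam => τ h
  let s : ℕ → List G.Config × G.Config := fun n =>
    n.rec ([γ], γ) (fun _ s => (s.1 ++ [next s.1 s.2], next s.1 s.2))
  let π : ℕ → G.Config := fun n => (s n).2
  have hist : ∀ n, history π n = (s n).1 := by
    intro n
    induction n with
    | zero => rfl
    | succ n ih => rw [history_succ, ih]
  have hπ : ∀ n, π (n + 1) = next (history π n) (π n) := fun n => by rw [hist]
  have heve : ∀ n, (π n).turn = .eve → π (n + 1) = σ (history π n) := by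
    intro n hn
    simp only [hπ, next, hn]
  have hadam : ∀ n, (π n).turn = .adam → π (n + 1) = τ (history π n) := by
    intro n hn
    simp only [hπ, next, hn]
  have hmove : ∀ n, Move (π n) (π (n + 1)) := by
    intro n
    induction n using Nat.strong_induction_on with
    | _ n ih =>
      rcases hn : (π n).turn with _ | _
      · rw [heve n hn]
        exact (hσ π rfl).1 n (fun k hk => ⟨ih k hk, heve k⟩) hn
      · rw [hadam n hn]
        exact (hτ π rfl).1 n (fun k hk => ⟨ih k hk, hadam k⟩) hn
  obtain ⟨r, hr, hre⟩ := (hσ π rfl).2 (fun n k _ => ⟨hmove k, heve k⟩)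
  obtain ⟨r', hr', hra⟩ := (hτ π rfl).2 (fun n k _ => ⟨hmove k, hadam k⟩)
  obtain rfl := hr.unique hr'
  rcases h : G.rankOwner r with _ | _
  · exact hre h
  · exact hra h

/-- Winning by a strategy with memory in `T`: it suffices to maintain an invariant `Inv` between
the memory and the current configuration, whatever the opponent does, in such a way that all
infinite plays along which the memory is updated as in `Step` are won. -/
theorem wins_of_invariant {T : Type*} {P : Player} {Inv : T → G.Config → Prop}
    {Step : T → G.Config → T → Prop}
    (hown : ∀ t γ, Inv t γ → γ.turn = P → ∃ γ' t', Move γ γ' ∧ Inv t' γ' ∧ Step t γ t')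
    (hopp : ∀ t γ γ', Inv t γ → γ.turn ≠ P → Move γ γ' → ∃ t', Inv t' γ' ∧ Step t γ t')
    (hinf : ∀ (π : ℕ → G.Config) (t : ℕ → T), (∀ n, Move (π n) (π (n + 1))) →
      (∀ n, Step (t n) (π n) (t (n + 1))) → WinsInfinite P π)
    {t₀ : T} {γ₀ : G.Config} (h₀ : Inv t₀ γ₀) : Wins P γ₀ := by
  have : Nonempty T := ⟨t₀⟩
  have : Nonempty G.Config := ⟨γ₀⟩
  -- `next` updates the memory, and `mem` computes it, with the last configuration, from a history
  let next : T → G.Config → G.Config → T := fun t γ γ' =>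
    Classical.epsilon fun t' => Inv t' γ' ∧ Step t γ t'
  let mv : T → G.Config → G.Config := fun t γ =>
    Classical.epsilon fun γ' => Move γ γ' ∧ ∃ t', Inv t' γ' ∧ Step t γ t'
  let mem : List G.Config → T × G.Config := fun h =>
    h.tail.foldl (fun s γ' => (next s.1 s.2 γ', γ')) (t₀, γ₀)
  refine ⟨fun h => mv (mem h).1 (mem h).2, ?_⟩
  intro π hπ
  let t : ℕ → T := fun n => n.rec t₀ (fun k s => next s (π k) (π (k + 1)))
  have hmem : ∀ n, mem (history π n) = (t n, π n) := by
    intro n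
    induction n with
    | zero => simp [mem, history_zero, t, hπ]
    | succ n ih =>
      have hne : history π n ≠ [] := by simp [history]
      have : mem (history π (n + 1)) =
          (next (mem (history π n)).1 (mem (history π n)).2 (π (n + 1)), π (n + 1)) := by
        simp [mem, history_succ, List.tail_append_of_ne_nil hne]
      rw [this, ih]
  have hmv : ∀ n, Inv (t n) (π n) → (π n).turn = P → Move (π n) (mv (t n) (π n)) ∧
      ∃ t', Inv t' (mv (t n) (π n)) ∧ Step (t n) (π n) t' := by
    intro n hn hturn
    obtain ⟨γ', t', h1, h2⟩ := hown _ _ hn hturn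
    exact Classical.epsilon_spec
      (p := fun γ' => Move (π n) γ' ∧ ∃ t', Inv t' γ' ∧ Step (t n) (π n) t') ⟨γ', h1, t', h2⟩
  have hstep : ∀ n, Inv (t n) (π n) → Move (π n) (π (n + 1)) →
      ((π n).turn = P → π (n + 1) = mv (mem (history π n)).1 (mem (history π n)).2) →
      Inv (t (n + 1)) (π (n + 1)) ∧ Step (t n) (π n) (t (n + 1)) := by
    intro n hn hmove hcons
    refine Classical.epsilon_spec
      (p := fun t' => Inv t' (π (n + 1)) ∧ Step (t n) (π n) t') ?_
    by_cases hturn : (π n).turn = P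
    · rw [hcons hturn, hmem]
      exact (hmv n hn hturn).2
    · exact hopp _ _ _ hn hturn hmove
  have hinv : ∀ n, ConsistentUpTo P (fun h => mv (mem h).1 (mem h).2) π n →
      Inv (t n) (π n) := by
    intro n
    induction n with
    | zero => intro _; simpa [t, hπ] using h₀
    | succ n ih =>
      intro hc
      exact (hstep n (ih fun k hk => hc k (hk.trans n.lt_succ_self)) (hc n n.lt_succ_self).1
        (hc n n.lt_succ_self).2).1
  refine ⟨fun n hc hturn => ?_, fun hc => hinf π t (fun n => (hc (n + 1) n n.lt_succ_self).1)
    fun n => (hstep n (hinv n (hc n)) (hc (n + 1) n n.lt_succ_self).1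
      (hc (n + 1) n n.lt_succ_self).2).2⟩
  change Move (π n) (mv (mem (history π n)).1 (mem (history π n)).2)
  rw [hmem]
  exact (hmv n (hinv n hc) hturn).1

/-- The counters of a configuration. -/
def Config.ctr : G.Config → G.Ctr
  | .positional _ ctr => ctr
  | .countdown _ ctr => ctr

/-- `t` assigns to every rank an ordinal that a player of interest wants to decrease, and `t'` is an
admissible new assignment after a move from the given configuration. Only the countdown
configurations of positions in `C` count: there, the ordinals of lower ranks may be reset, and the
ordinal of the current rank has to decrease if it is standard and belongs to `P`. -/
def MemoryStep (P : Player) (C : V → Prop) (t : R → Ordinal.{u}) (γ : G.Config)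
    (t' : R → Ordinal.{u}) : Prop :=
  match γ with
  | .positional _ _ => t' = t
  | .countdown v _ =>
    (¬ C v → t' = t) ∧ (∀ r, G.rank v < r → t' r = t r) ∧
      (C v → G.rank v ∉ G.nonstd → G.rankOwner (G.rank v) = P → t' (G.rank v) < t (G.rank v))

/-- If countdown configurations in `C` recur, and all other positions have the lowest rank, then
`P` wins a play along which the ordinals decrease as in `MemoryStep`. For a nonstandard rank it is
the counter of the game that decreases, so that such a rank is never the greatest recurring one. -/
theorem winsInfinite_of_memoryStep [OrderBot R] {P : Player} {C : V → Prop}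
    {π : ℕ → G.Config} {t : ℕ → R → Ordinal.{u}} (hmove : ∀ n, Move (π n) (π (n + 1)))
    (hstep : ∀ n, MemoryStep P C (t n) (π n) (t (n + 1)))
    (hbot : ∀ n, ¬ C (π n).position → G.rank (π n).position = ⊥)
    (hC : ∃ᶠ n in Filter.atTop, ∃ v ctr, π n = .countdown v ctr ∧ C v) : WinsInfinite P π := by
  let S : Set R := {s | ∃ᶠ n in Filter.atTop, G.rank (π n).position = s}
  have hne : S.Nonempty := by
    by_contra hcon
    have h : ∀ s : R, ∀ᶠ n in Filter.atTop, ¬ G.rank (π n).position = s := fun s =>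
      Filter.not_frequently.1 fun hs => hcon ⟨s, hs⟩
    obtain ⟨n, hn⟩ := (Filter.eventually_all.2 h).exists
    exact hn _ rfl
  obtain ⟨r, hr⟩ : ∃ r, IsGreatest S r := by
    obtain ⟨r, hr⟩ := S.toFinite.exists_maximal hne
    exact ⟨r, hr.1, fun s hs => le_of_not_gt fun h => h.not_ge (hr.2 hs h.le)⟩
  refine ⟨r, hr, fun hown => ?_⟩
  have hle : ∀ᶠ n in Filter.atTop, G.rank (π n).position ≤ r := by
    have h : ∀ s : R, ∀ᶠ n in Filter.atTop, r < s → ¬ G.rank (π n).position = s := fun s => by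
      by_cases hs : r < s
      · exact (Filter.not_frequently.1 fun hf => hs.not_ge (hr.2 hf)).mono fun _ h _ => h
      · exact Filter.Eventually.of_forall fun _ h => absurd h hs
    exact (Filter.eventually_all.2 h).mono fun n hn => le_of_not_gt fun hlt => hn _ hlt rfl
  have hfreq : ∃ᶠ n in Filter.atTop, ∃ v ctr, π n = .countdown v ctr ∧ C v ∧ G.rank v = r := by
    by_cases hrb : r = ⊥
    · refine (hC.and_eventually hle).mono ?_
      rintro n ⟨⟨v, ctr, hv, hCv⟩, hn⟩
      rw [hv, hrb] at hn
      exact ⟨v, ctr, hv, hCv, (le_bot_iff.1 hn).trans hrb.symm⟩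
    · refine Filter.frequently_atTop.2 fun N => ?_
      obtain ⟨n, hn, hnr⟩ := Filter.frequently_atTop.1 hr.1 (N + 1)
      have hCn : C (π n).position := by
        by_contra hcon
        exact hrb (hnr.symm.trans (hbot n hcon))
      rcases hπ : π n with ⟨v, ctr⟩ | ⟨v, ctr⟩
      · obtain ⟨k, rfl⟩ : ∃ k, n = k + 1 := ⟨n - 1, by omega⟩
        have hm := hmove k
        rw [hπ] at hm hnr hCn
        cases hk : π k with
        | positional w c => rw [hk] at hm; cases hm
        | countdown w c =>
          rw [hk] at hm
          cases hm
          exact ⟨k, by omega, v, c, hk, hCn, hnr⟩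
      · rw [hπ] at hnr hCn
        exact ⟨n, by omega, v, ctr, hπ, hCn, hnr⟩
  by_cases hrn : r ∈ G.nonstd
  · refine not_frequently_lt (f := fun n => (π n).ctr ⟨r, hrn⟩) (hle.mono fun n hn => ?_)
      (hfreq.mono ?_)
    · have hm := hmove n
      cases hk : π n with
      | positional w c =>
        rw [hk] at hm
        cases h' : π (n + 1) <;> rw [h'] at hm <;> cases hm
        exact le_rfl
      | countdown w c =>
        rw [hk] at hm hn
        cases h' : π (n + 1) <;> rw [h'] at hm <;> cases hm
        rename_i decrement keep
        rcases hn.lt_or_eq with h | h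
        · exact (keep ⟨r, hrn⟩ h).le
        · exact (decrement ⟨r, hrn⟩ h.symm).le
    · rintro n ⟨v, ctr, hv, -, hvr⟩
      have hm := hmove n
      rw [hv] at hm
      cases h' : π (n + 1) <;> rw [h'] at hm <;> cases hm
      rename_i decrement _
      simp only [hv, Config.ctr]
      exact decrement ⟨r, hrn⟩ hvr.symm
  · refine not_frequently_lt (f := fun n => t n r) (hle.mono fun n hn => ?_) (hfreq.mono ?_)
    · have hs := hstep n
      cases hk : π n with
      | positional w c =>
        rw [hk] at hs
        exact (congrFun hs r).le
      | countdown w c =>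
        rw [hk] at hs hn
        obtain ⟨h1, h2, h3⟩ := hs
        by_cases hCw : C w
        · rcases hn.lt_or_eq with h | h
          · exact (h2 r h).le
          · obtain rfl : G.rank w = r := h
            exact (h3 hCw hrn hown).le
        · exact (congrFun (h1 hCw) r).le
    · rintro n ⟨v, ctr, hv, hCv, rfl⟩
      have hs := hstep n
      rw [hv] at hs
      exact hs.2.2 hCv hrn hown

end CountdownGame

/-! ### Approximants and valuations along a path -/

/-- The claim that the given player defends: `a` for Eve, its negation for Adam. -/
def Player.Claims : Player → Prop → Prop
  | .eve, a => a
  | .adam, a => ¬ a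

theorem approx_top {A : Type u} [CompleteLattice A] (η : FixKind) (F : A →o A) :
    approx η ⊤ F = F (approx η ⊤ F) := by
  cases η
  · exact F.map_lfp.symm
  · exact F.map_gfp.symm

/-- All sufficiently large ordinal approximants are the fixpoint itself. -/
theorem approx_coe_eq_approx_top {A : Type u} [CompleteLattice A] (η : FixKind) (F : A →o A)
    {κ : Ordinal.{u}} (hκ : (Order.succ (Cardinal.mk A)).ord ≤ κ) :
    approx η (κ : WithTop Ordinal.{u}) F = approx η ⊤ F := by
  cases η
  · change OrdinalApprox.lfpApprox F ⊥ κ = F.lfp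
    rw [← OrdinalApprox.lfpApprox_ord_eq_lfp]
    refine OrdinalApprox.lfpApprox_eq_of_mem_fixedPoints F hκ ?_
    exact OrdinalApprox.lfpApprox_ord_mem_fixedPoint F bot_le
  · change OrdinalApprox.gfpApprox F ⊤ κ = F.gfp
    rw [← OrdinalApprox.gfpApprox_ord_eq_gfp]
    refine OrdinalApprox.gfpApprox_eq_of_mem_fixedPoints F hκ ?_
    exact OrdinalApprox.gfpApprox_ord_mem_fixedPoint F le_top

/-- One ordinal beyond which the approximants of all maps of tuples of subsets of `M` are
stable. -/
noncomputable def closureOrdinal (M : Type u) : Ordinal.{u} :=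
  ⨆ n : ULift.{u} ℕ, (Order.succ (Cardinal.mk (Fin n.down → Set M))).ord

theorem approx_closureOrdinal {M : Type u} {n : ℕ} (η : FixKind)
    (F : (Fin n → Set M) →o (Fin n → Set M)) :
    approx η (closureOrdinal M : WithTop Ordinal.{u}) F = approx η ⊤ F :=
  approx_coe_eq_approx_top η F
    (Ordinal.le_iSup (fun n : ULift.{u} ℕ =>
      (Order.succ (Cardinal.mk (Fin n.down → Set M))).ord) ⟨n⟩)

theorem mem_approx_mu {M : Type u} {n : ℕ} (F : (Fin n → Set M) →o (Fin n → Set M))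
    (a : Ordinal.{u}) (j : Fin n) (m : M) : m ∈ approx .mu (a : WithTop Ordinal.{u}) F j ↔
      ∃ b < a, m ∈ F (approx .mu (b : WithTop Ordinal.{u}) F) j := by
  change m ∈ OrdinalApprox.lfpApprox F ⊥ a j ↔ ∃ b < a, m ∈ F (OrdinalApprox.lfpApprox F ⊥ b) j
  rw [OrdinalApprox.lfpApprox]
  simp

theorem mem_approx_nu {M : Type u} {n : ℕ} (F : (Fin n → Set M) →o (Fin n → Set M))
    (a : Ordinal.{u}) (j : Fin n) (m : M) : m ∈ approx .nu (a : WithTop Ordinal.{u}) F j ↔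
      ∀ b < a, m ∈ F (approx .nu (b : WithTop Ordinal.{u}) F) j := by
  change m ∈ OrdinalApprox.gfpApprox F ⊤ a j ↔ ∀ b < a, m ∈ F (OrdinalApprox.gfpApprox F ⊤ b) j
  rw [OrdinalApprox.gfpApprox]
  simp

/-- The owner of an operator can choose the next approximant. -/
theorem exists_claims_of_claims_approx {M : Type u} {n : ℕ} {P : Player} {η : FixKind}
    (hη : η.owner = P) {F : (Fin n → Set M) →o (Fin n → Set M)} {a : Ordinal.{u}} {j : Fin n}
    {m : M} (h : P.Claims (m ∈ approx η (a : WithTop Ordinal.{u}) F j)) :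
    ∃ b < a, P.Claims (m ∈ F (approx η (b : WithTop Ordinal.{u}) F) j) := by
  subst hη
  cases η
  · exact (mem_approx_mu F a j m).1 h
  · simpa [Player.Claims, FixKind.owner, mem_approx_nu] using h

/-- A claim about an operator of the opponent survives every choice of the next approximant. -/
theorem claims_of_claims_approx {M : Type u} {n : ℕ} {P : Player} {η : FixKind}
    (hη : η.owner ≠ P) {F : (Fin n → Set M) →o (Fin n → Set M)} {a b : Ordinal.{u}} {j : Fin n}
    {m : M} (h : P.Claims (m ∈ approx η (a : WithTop Ordinal.{u}) F j)) (hb : b < a) :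
    P.Claims (m ∈ F (approx η (b : WithTop Ordinal.{u}) F) j) := by
  cases η <;> cases P
  · exact absurd rfl hη
  · simp only [Player.Claims, mem_approx_mu, not_exists, not_and] at h
    exact h b hb
  · exact (mem_approx_nu F a j m).1 h b hb
  · exact absurd rfl hη

namespace Formula

variable {Act Var : Type*} {M : Type u}

/-- The valuation under the topmost operator of a formula, if the variables that this operator
binds are interpreted by its approximant with index `a`. -/
noncomputable def bindVal (step : Act → M → M → Prop) (a : WithTop Ordinal.{u}) :
    Formula.{u} Act Var → (Var → Set M) → (Var → Set M)
  | .fix η _ _ x θ, val => update val x (approx η a (tupleMap x (fun j => (θ j).sem step) val))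
  | _, val => val

/-- The valuation at the path `p` in `φ`, if the variables bound by the operator at a path `w` are
interpreted by its approximant with index `A w`. -/
noncomputable def valAt (step : Act → M → M → Prop) :
    (List ℕ → WithTop Ordinal.{u}) → Formula.{u} Act Var → List ℕ → (Var → Set M) → (Var → Set M)
  | _, _, [], val => val
  | A, φ, k :: p, val =>
    match φ.child k with
    | none => val
    | some ψ => valAt step (fun w => A (k :: w)) ψ p (φ.bindVal step (A []) val)

variable {step : Act → M → M → Prop}

theorem valAt_snoc {A : List ℕ → WithTop Ordinal.{u}} {φ ψ : Formula.{u} Act Var} {p : List ℕ}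
    (hp : φ.sub p = some ψ) {k : ℕ} (hk : (ψ.child k).isSome) (val : Var → Set M) :
    valAt step A φ (p ++ [k]) val = ψ.bindVal step (A p) (valAt step A φ p val) := by
  induction p generalizing φ A val with
  | nil =>
    obtain rfl : φ = ψ := by simpa [sub] using hp
    obtain ⟨χ, hχ⟩ := Option.isSome_iff_exists.1 hk
    simp [valAt, hχ]
  | cons l p ih =>
    cases hl : φ.child l with
    | none => simp [sub, hl] at hp
    | some χ =>
      simp only [sub, hl, Option.bind_some] at hp
      simp only [List.cons_append, valAt, hl]
      exact ih hp _

/-- Only the operators above `p` matter for the valuation at `p`. -/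
theorem valAt_congr {A A' : List ℕ → WithTop Ordinal.{u}} {φ : Formula.{u} Act Var} {p : List ℕ}
    (h : ∀ w k n (η : FixKind) (α : WithTop Ordinal.{u}) (i : Fin n) (x : Fin n → Var)
      (θ : Fin n → Formula.{u} Act Var), w ++ [k] <+: p → φ.sub w = some (.fix η α i x θ) →
        k < n → A w = A' w) (val : Var → Set M) :
    valAt step A φ p val = valAt step A' φ p val := by
  induction p generalizing φ A A' val with
  | nil => rfl
  | cons l p ih =>
    cases hl : φ.child l with
    | none => simp [valAt, hl]
    | some χ =>
      have hbind : φ.bindVal step (A []) val = φ.bindVal step (A' []) val := by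
        cases φ with
        | @fix η α n i x θ =>
          have hln : l < n := by
            by_contra hcon
            simp [child, hcon] at hl
          rw [h [] l n η α i x θ (by simp) rfl hln]
        | _ => rfl
      simp only [valAt, hl, hbind]
      refine ih (fun w k n η α i x θ hw hs hk => h (l :: w) k n η α i x θ ?_ ?_ hk) _
      · simpa using hw
      · simpa [sub, hl] using hs

theorem bindVal_of_bindIndex_eq_none {φ : Formula.{u} Act Var} {v : Var}
    (h : φ.bindIndex v = none) (a : WithTop Ordinal.{u}) (val : Var → Set M) :
    φ.bindVal step a val v = val v := by
  cases φ with
  | fix η α i x θ =>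
    simp only [bindIndex, Option.map_eq_none_iff] at h
    simp [bindVal, update, h]
  | _ => rfl

/-- Free variables keep their value. -/
theorem valAt_of_target_eq_none {A : List ℕ → WithTop Ordinal.{u}} {φ : Formula.{u} Act Var}
    {p : List ℕ} {v : Var} (h : φ.target p v = none) (val : Var → Set M) :
    valAt step A φ p val v = val v := by
  induction p generalizing φ A val with
  | nil => rfl
  | cons l p ih =>
    cases hl : φ.child l with
    | none => simp [valAt, hl]
    | some χ =>
      simp only [target, hl] at h
      simp only [valAt, hl]
      cases ht : χ.target p v with
      | some q => simp [ht] at h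
      | none =>
        simp only [ht, Option.map_eq_none_iff] at h
        rw [ih ht, bindVal_of_bindIndex_eq_none h]

/-- The value of a bound variable is a component of the approximant chosen for the operator that
binds it. -/
theorem valAt_of_target_eq_some {φ : Formula.{u} Act Var} {p t : List ℕ} {v : Var}
    (h : φ.target p v = some t) :
    ∃ (w : List ℕ) (n : ℕ) (η : FixKind) (α : WithTop Ordinal.{u}) (i : Fin n) (x : Fin n → Var)
      (θ : Fin n → Formula.{u} Act Var) (j : Fin n),
      φ.sub w = some (.fix η α i x θ) ∧ t = w ++ [j.1] ∧
      ∀ (A : List ℕ → WithTop Ordinal.{u}) (val : Var → Set M), valAt step A φ p val v =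
        approx η (A w) (tupleMap x (fun j => (θ j).sem step) (valAt step A φ w val)) j := by
  induction p generalizing φ t with
  | nil => simp [target] at h
  | cons l p ih =>
    cases hl : φ.child l with
    | none => simp [target, hl] at h
    | some χ =>
      simp only [target, hl] at h
      cases ht : χ.target p v with
      | some q =>
        simp only [ht, Option.some.injEq] at h
        obtain ⟨w, n, η, α, i, x, θ, j, hs, rfl, hv⟩ := ih ht
        refine ⟨l :: w, n, η, α, i, x, θ, j, by simpa [sub, hl] using hs, by simp [← h], ?_⟩
        intro A val
        simp only [valAt, hl]
        exact hv _ _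
      | none =>
        simp only [ht, Option.map_eq_some_iff] at h
        obtain ⟨j, hj, rfl⟩ := h
        cases φ <;> simp only [bindIndex, reduceCtorEq, Option.map_eq_some_iff] at hj
        rename_i η α n i x θ
        obtain ⟨j, hj, rfl⟩ := hj
        refine ⟨[], n, η, α, i, x, θ, j, rfl, rfl, ?_⟩
        intro A val
        simp only [valAt, hl, valAt_of_target_eq_none ht]
        simp [bindVal, update, hj]

end Formula

namespace Formula

variable {Act Var : Type*} {φ : Formula.{u} Act Var}

/-! ### Occurrences and their ranks -/

/-- The path `p` leads to a component of the tuple of a fixpoint operator. -/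
def InTuple (φ : Formula.{u} Act Var) (p : List ℕ) : Prop :=
  ∃ (w : List ℕ) (n : ℕ) (η : FixKind) (α : WithTop Ordinal.{u}) (i : Fin n) (x : Fin n → Var)
    (θ : Fin n → Formula.{u} Act Var) (j : Fin n),
    φ.sub w = some (.fix η α i x θ) ∧ p = w ++ [j.1]

theorem inTuple_snoc {p : List ℕ} {k : ℕ} (h : φ.InTuple (p ++ [k])) :
    ∃ (n : ℕ) (η : FixKind) (α : WithTop Ordinal.{u}) (i : Fin n) (x : Fin n → Var)
      (θ : Fin n → Formula.{u} Act Var), φ.sub p = some (.fix η α i x θ) ∧ k < n := by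
  obtain ⟨w, n, η, α, i, x, θ, j, hw, h⟩ := h
  obtain ⟨rfl, h⟩ := List.append_inj' h rfl
  obtain rfl : k = j := by simpa using h
  exact ⟨n, η, α, i, x, θ, hw, j.2⟩

theorem sub_component {w : List ℕ} {n : ℕ} {η : FixKind} {α : WithTop Ordinal.{u}} {i : Fin n}
    {x : Fin n → Var} {θ : Fin n → Formula.{u} Act Var} (hw : φ.sub w = some (.fix η α i x θ))
    (j : Fin n) : φ.sub (w ++ [j.1]) = some (θ j) := by
  simp [sub_append, hw, sub, child]

theorem isComponent_of_sub {w : List ℕ} {n : ℕ} {η : FixKind} {α : WithTop Ordinal.{u}}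
    {i : Fin n} {x : Fin n → Var} {θ : Fin n → Formula.{u} Act Var}
    (hw : φ.sub w = some (.fix η α i x θ)) (j : Fin n) :
    φ.IsComponent w η α ⟨w ++ [j.1], by simp [sub_component hw j]⟩ :=
  ⟨n, i, x, θ, j, hw, rfl⟩

theorem freeVar_eq_some {p : List ℕ} {v : Var} (h : φ.freeVar p = some v) :
    φ.sub p = some (.var v) ∧ φ.target p v = none := by
  unfold freeVar at h
  split at h
  · split at h
    · cases h
      exact ⟨by assumption, by assumption⟩
    · cases h
  · cases h

theorem locate_of_freeVar_eq_some {p : List ℕ} {v : Var} (hv : φ.freeVar p = some v)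
    (h : (φ.sub p).isSome) : φ.locate p h = .inr v := by
  unfold locate
  split <;> simp_all

theorem locate_of_freeVar_eq_none {p : List ℕ} (hv : φ.freeVar p = none)
    (h : (φ.sub p).isSome) : φ.locate p h = .inl ⟨p, h, hv⟩ := by
  unfold locate
  split <;> simp_all

theorem eq_of_locate_eq_inl {p : List ℕ} {h : (φ.sub p).isSome} {q : φ.State}
    (hq : φ.locate p h = .inl q) : q.1 = p := by
  cases hv : φ.freeVar p with
  | some v => simp [locate_of_freeVar_eq_some hv h] at hq
  | none =>
    rw [locate_of_freeVar_eq_none hv h] at hq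
    cases hq
    rfl

namespace Ranking

variable {R : Type*} [LinearOrder R] [Finite R] [OrderBot R] (ρ : φ.Ranking R)

open Classical in
/-- The rank of the subformula at a path, extended by `⊥` to paths outside of `φ`. -/
noncomputable def rk (p : List ℕ) : R :=
  if h : (φ.sub p).isSome then ρ.rank ⟨p, h⟩ else ⊥

theorem rk_eq_rank {p : List ℕ} (h : (φ.sub p).isSome) : ρ.rk p = ρ.rank ⟨p, h⟩ := dif_pos h

theorem rk_eq_bot {p : List ℕ} (h : ¬ φ.InTuple p) : ρ.rk p = ⊥ := by
  by_cases hp : (φ.sub p).isSome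
  · rw [ρ.rk_eq_rank hp]
    refine ρ.rank_eq_bot _ ?_
    rintro w η α ⟨n, i, x, θ, j, hw, h'⟩
    exact h ⟨w, n, η, α, i, x, θ, j, hw, h'⟩
  · exact dif_neg hp

theorem rk_lt_rk {p p' : List ℕ} (h : φ.InTuple p) (h' : φ.InTuple p') (hpre : p' <+: p)
    (hne : p' ≠ p) : ρ.rk p < ρ.rk p' := by
  obtain ⟨w, n, η, α, i, x, θ, j, hw, rfl⟩ := h
  obtain ⟨w', n', η', α', i', x', θ', j', hw', rfl⟩ := h'
  rw [ρ.rk_eq_rank (by simp [sub_component hw j]), ρ.rk_eq_rank (by simp [sub_component hw' j'])]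
  exact ρ.rank_lt _ _ _ _ _ _ _ _ (isComponent_of_sub hw j) (isComponent_of_sub hw' j') hpre hne

section

variable {w : List ℕ} {n : ℕ} {η : FixKind} {α : WithTop Ordinal.{u}} {i : Fin n}
  {x : Fin n → Var} {θ : Fin n → Formula.{u} Act Var} (hw : φ.sub w = some (.fix η α i x θ))

include hw

theorem rk_component (j : Fin n) : ρ.rk (w ++ [j.1]) = ρ.rk (w ++ [0]) := by
  have hj : w ++ [0] = w ++ [(⟨0, j.pos⟩ : Fin n).1] := rfl
  rw [hj, ρ.rk_eq_rank (by simp [sub_component hw j]),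
    ρ.rk_eq_rank (by simp [sub_component hw ⟨0, j.pos⟩])]
  exact ρ.rank_eq _ _ _ _ _ (isComponent_of_sub hw j) (isComponent_of_sub hw ⟨0, j.pos⟩)

theorem rankOwner_rk : ρ.rankOwner (ρ.rk (w ++ [0])) = η.owner := by
  rw [← ρ.rk_component hw i, ρ.rk_eq_rank (by simp [sub_component hw i])]
  exact ρ.rank_owner _ _ _ _ (isComponent_of_sub hw i)

end

theorem rk_notMem_nonstd {w : List ℕ} {n : ℕ} {η : FixKind} {i : Fin n}
    {x : Fin n → Var} {θ : Fin n → Formula.{u} Act Var}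
    (hw : φ.sub w = some (.fix η ⊤ i x θ)) : ρ.rk (w ++ [0]) ∉ ρ.nonstd := by
  rw [← ρ.rk_component hw i, ρ.rk_eq_rank (by simp [sub_component hw i])]
  exact ρ.rank_standard _ _ _ (isComponent_of_sub hw i)

theorem rk_mem_nonstd {w : List ℕ} {n : ℕ} {η : FixKind} {α : Ordinal.{u}} {i : Fin n}
    {x : Fin n → Var} {θ : Fin n → Formula.{u} Act Var}
    (hw : φ.sub w = some (.fix η α i x θ)) :
    ∃ h : ρ.rk (w ++ [0]) ∈ ρ.nonstd, ρ.ctrI ⟨ρ.rk (w ++ [0]), h⟩ = α := by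
  rw [← ρ.rk_component hw i, ρ.rk_eq_rank (by simp [sub_component hw i])]
  exact ρ.rank_nonstd _ _ _ _ (isComponent_of_sub hw i)

/-! ### Virtual counters -/

variable (P : Player)

open Classical in
/-- The approximants that interpret the variables bound by the operator at the path `w`, from the
point of view of `P`, who has in mind the ordinals `t`: a standard operator of the opponent is
interpreted by its fixpoint, and all other operators by the ordinal for their rank. -/
noncomputable def index (t : R → Ordinal.{u}) (w : List ℕ) : WithTop Ordinal.{u} :=
  if ρ.rk (w ++ [0]) ∉ ρ.nonstd ∧ ρ.rankOwner (ρ.rk (w ++ [0])) ≠ P then ⊤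
  else (t (ρ.rk (w ++ [0])) : WithTop Ordinal.{u})

open Classical in
/-- The ordinals for fresh ranks: the initial counter value, or for a standard rank an ordinal at
which all fixpoints in the model `M` have been reached. -/
noncomputable def initMem (M : Type u) (r : R) : Ordinal.{u} :=
  if h : r ∈ ρ.nonstd then ρ.ctrI ⟨r, h⟩ else closureOrdinal M

open Classical in
/-- How `P` translates the value `c` of the counter at a nonstandard rank into an ordinal `a`. If
the initial value is infinite then one step is held in reserve, in favour of the opponent: `P`
keeps the own counters positive, so that they admit a further step at the position of a free
variable, and assumes that the opponent has a step left. This is possible since `1 + a = a` for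
infinite `a`. -/
def Link (r : ρ.nonstd) (c a : Ordinal.{u}) : Prop :=
  if Ordinal.omega0 ≤ ρ.ctrI r then
    if ρ.rankOwner r = P then c = 1 + a else a = 1 + c
  else a = c

/-- The ordinals `t` correspond to the counters `ctr` at all nonstandard ranks. -/
def Linked (t : R → Ordinal.{u}) (ctr : ρ.nonstd → Ordinal.{u}) : Prop :=
  ∀ r : ρ.nonstd, ρ.Link P r (ctr r) (t r)

theorem link_ctrI (r : ρ.nonstd) : ρ.Link P r (ρ.ctrI r) (ρ.ctrI r) := by
  unfold Link
  split_ifs with h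
  · exact (Ordinal.one_add_of_omega0_le h).symm
  · exact (Ordinal.one_add_of_omega0_le h).symm
  · rfl

theorem linked_initMem (M : Type u) : ρ.Linked P (ρ.initMem M) ρ.ctrI := by
  intro r
  simp only [initMem, Subtype.coe_prop, dif_pos]
  exact ρ.link_ctrI P r

variable {P}

theorem exists_link_lt_of_own {r : ρ.nonstd} (hr : ρ.rankOwner r = P) {c a b : Ordinal.{u}}
    (h : ρ.Link P r c a) (hb : b < a) : ∃ c' < c, ρ.Link P r c' b := by
  unfold Link at *
  simp only [hr, if_true] at *
  split_ifs at * with hω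
  · subst h
    exact ⟨1 + b, by gcongr, rfl⟩
  · subst h
    exact ⟨b, hb, rfl⟩

theorem exists_link_lt_of_opp {r : ρ.nonstd} (hr : ρ.rankOwner r ≠ P) {c a c' : Ordinal.{u}}
    (h : ρ.Link P r c a) (hc : c' < c) : ∃ b < a, ρ.Link P r c' b := by
  unfold Link at *
  simp only [hr, if_false] at *
  split_ifs at * with hω
  · subst h
    exact ⟨1 + c', by gcongr, rfl⟩
  · subst h
    exact ⟨c', hc, rfl⟩

open Classical in
/-- The ordinals after a visit to rank `s` at which the ordinal for `s` changes to `b`. -/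
noncomputable def updateMem (M : Type u) (t : R → Ordinal.{u}) (s : R) (b : Ordinal.{u}) (r : R) :
    Ordinal.{u} :=
  if r < s then ρ.initMem M r else if r = s then b else t r

theorem updateMem_of_lt {M : Type u} {t : R → Ordinal.{u}} {s r : R} {b : Ordinal.{u}}
    (h : r < s) : ρ.updateMem M t s b r = ρ.initMem M r := if_pos h

theorem updateMem_self {M : Type u} {t : R → Ordinal.{u}} {s : R} {b : Ordinal.{u}} :
    ρ.updateMem M t s b s = b := by
  simp [updateMem]

theorem updateMem_of_gt {M : Type u} {t : R → Ordinal.{u}} {s r : R} {b : Ordinal.{u}}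
    (h : s < r) : ρ.updateMem M t s b r = t r := by
  simp [updateMem, h.not_gt, h.ne']

theorem linked_updateMem {M : Type u} {t : R → Ordinal.{u}} {s : R} {b : Ordinal.{u}}
    {ctr ctr' : ρ.nonstd → Ordinal.{u}} (h : ρ.Linked P t ctr)
    (reset : ∀ r : ρ.nonstd, r < s → ctr' r = ρ.ctrI r)
    (link : ∀ r : ρ.nonstd, r = s → ρ.Link P r (ctr' r) b)
    (keep : ∀ r : ρ.nonstd, s < r → ctr' r = ctr r) :
    ρ.Linked P (ρ.updateMem M t s b) ctr' := by
  intro r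
  rcases lt_trichotomy (r : R) s with hr | hr | hr
  · rw [ρ.updateMem_of_lt hr, reset r hr]
    have := ρ.linked_initMem P M r
    exact this
  · have := link r hr
    rwa [← hr, ρ.updateMem_self]
  · rw [ρ.updateMem_of_gt hr, keep r hr]
    exact h r

theorem index_congr {t t' : R → Ordinal.{u}} {w : List ℕ}
    (h : t (ρ.rk (w ++ [0])) = t' (ρ.rk (w ++ [0]))) : ρ.index P t w = ρ.index P t' w := by
  simp only [index, h]

/-- The ordinals of all ranks below those of the tuple components around the path `p` are
fresh. -/
def Fresh (M : Type u) (t : R → Ordinal.{u}) (p : List ℕ) : Prop :=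
  ∀ r, (∀ p', φ.InTuple p' → p' <+: p → r < ρ.rk p') → t r = ρ.initMem M r

/-- When an operator is entered from above, its fresh ordinal amounts to the ordinal of the
operator. -/
theorem approx_index_of_fresh {M : Type u} {t : R → Ordinal.{u}} {w : List ℕ} {n : ℕ}
    {η : FixKind} {α : WithTop Ordinal.{u}} {i : Fin n} {x : Fin n → Var}
    {θ : Fin n → Formula.{u} Act Var} (hw : φ.sub w = some (.fix η α i x θ))
    (h : ρ.Fresh M t w) (F : (Fin n → Set M) →o (Fin n → Set M)) :
    approx η (ρ.index P t w) F = approx η α F := by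
  have hr : t (ρ.rk (w ++ [0])) = ρ.initMem M (ρ.rk (w ++ [0])) := by
    refine h _ fun p' hp' hpre => ?_
    rw [← ρ.rk_component hw i]
    refine ρ.rk_lt_rk ⟨w, n, η, α, i, x, θ, i, hw, rfl⟩ hp'
      (hpre.trans (List.prefix_append _ _)) ?_
    rintro rfl
    simpa using hpre.length_le
  unfold index
  induction α using WithTop.recTopCoe with
  | top =>
    have hstd := ρ.rk_notMem_nonstd hw
    split_ifs with hc
    · rfl
    · rw [hr, initMem, dif_neg hstd]
      exact approx_closureOrdinal η F
  | coe α =>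
    obtain ⟨hn, hctr⟩ := ρ.rk_mem_nonstd hw
    rw [if_neg (fun hc => hc.1 hn), hr, initMem, dif_pos hn, hctr]

end Ranking

/-- Unfolding an operator at the path `w` once, with the approximant of index `a` below, amounts to
evaluating a component of its tuple under the valuation at that component. -/
theorem tupleMap_approx_eq_sem {M : Type u} {step : Act → M → M → Prop} {w : List ℕ} {n : ℕ}
    {η : FixKind} {α : WithTop Ordinal.{u}} {i : Fin n} {x : Fin n → Var}
    {θ : Fin n → Formula.{u} Act Var} (hw : φ.sub w = some (.fix η α i x θ)) (j : Fin n)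
    {A A' : List ℕ → WithTop Ordinal.{u}} (val : Var → Set M)
    (hA : ∀ w' k n (η : FixKind) (α : WithTop Ordinal.{u}) (i : Fin n) (x : Fin n → Var)
      (θ : Fin n → Formula.{u} Act Var), w' ++ [k] <+: w → φ.sub w' = some (.fix η α i x θ) →
        k < n → A w' = A' w') :
    tupleMap x (fun j => (θ j).sem step) (valAt step A φ w val)
      (approx η (A' w) (tupleMap x (fun j => (θ j).sem step) (valAt step A φ w val))) j =
    (θ j).sem step (valAt step A' φ (w ++ [j.1]) val) := by
  rw [valAt_snoc hw (by simp [child]), ← valAt_congr hA]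
  rfl

end Formula

namespace Formula

variable {Act Var : Type*} {φ : Formula.{u} Act Var}

/-! ### The semantic game of the automaton of a formula -/

section Delta

variable {q : φ.State}

theorem delta_var {v : Var} (h : φ.sub q.1 = some (.var v)) :
    φ.delta q = .inl {z | ∃ t, ∃ ht : φ.target q.1 v = some t,
      z = φ.locate t (target_isSome ht)} := by
  unfold delta
  split <;> rename_i h' <;> cases h.symm.trans h'
  rfl

theorem delta_top (h : φ.sub q.1 = some .top) : φ.delta q = .inl ∅ := by
  unfold delta
  split <;> rename_i h' <;> cases h.symm.trans h'
  rfl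

theorem delta_bot (h : φ.sub q.1 = some .bot) : φ.delta q = .inl ∅ := by
  unfold delta
  split <;> rename_i h' <;> cases h.symm.trans h'
  rfl

theorem delta_or {ψ χ : Formula.{u} Act Var} (h : φ.sub q.1 = some (.or ψ χ)) :
    φ.delta q = .inl {φ.locate (q.1 ++ [0]) (sub_child h rfl),
      φ.locate (q.1 ++ [1]) (sub_child h rfl)} := by
  unfold delta
  split <;> rename_i h' <;> cases h.symm.trans h'
  rfl

theorem delta_and {ψ χ : Formula.{u} Act Var} (h : φ.sub q.1 = some (.and ψ χ)) :
    φ.delta q = .inl {φ.locate (q.1 ++ [0]) (sub_child h rfl),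
      φ.locate (q.1 ++ [1]) (sub_child h rfl)} := by
  unfold delta
  split <;> rename_i h' <;> cases h.symm.trans h'
  rfl

theorem delta_dia {τ : Act} {ψ : Formula.{u} Act Var} (h : φ.sub q.1 = some (.dia τ ψ)) :
    φ.delta q = .inr (τ, φ.locate (q.1 ++ [0]) (sub_child h rfl)) := by
  unfold delta
  split <;> rename_i h' <;> cases h.symm.trans h'
  rfl

theorem delta_box {τ : Act} {ψ : Formula.{u} Act Var} (h : φ.sub q.1 = some (.box τ ψ)) :
    φ.delta q = .inr (τ, φ.locate (q.1 ++ [0]) (sub_child h rfl)) := by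
  unfold delta
  split <;> rename_i h' <;> cases h.symm.trans h'
  rfl

theorem delta_fix {n : ℕ} {η : FixKind} {α : WithTop Ordinal.{u}} {i : Fin n}
    {x : Fin n → Var} {θ : Fin n → Formula.{u} Act Var}
    (h : φ.sub q.1 = some (.fix η α i x θ)) :
    φ.delta q = .inl {φ.locate (q.1 ++ [i.1]) (sub_child h (by simp [child]))} := by
  unfold delta
  split <;> rename_i h' <;> cases h.symm.trans h'
  rfl

end Delta

namespace Ranking

variable {R : Type*} [LinearOrder R] [Finite R] [OrderBot R] (ρ : φ.Ranking R)
  {M : Type u} (step : Act → M → M → Prop) (val : Var → Set M) (varRank : M → Var → R)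

/-- The semantic game of the automaton of `φ`. -/
noncomputable abbrev game : CountdownGame.{u} (M × (φ.State ⊕ Var)) R :=
  (φ.automaton ρ).game step val varRank

variable {ρ step val varRank}

theorem edge_of_delta_inl {m n : M} {q : φ.State} {z : φ.State ⊕ Var} {S : Set (φ.State ⊕ Var)}
    (h : φ.delta q = .inl S) :
    (ρ.game step val varRank).edge (m, .inl q) (n, z) ↔ n = m ∧ z ∈ S := by
  simp [CountdownAutomaton.game, automaton, h]

theorem edge_of_delta_inr {m n : M} {q : φ.State} {z p : φ.State ⊕ Var} {τ : Act}
    (h : φ.delta q = .inr (τ, p)) :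
    (ρ.game step val varRank).edge (m, .inl q) (n, z) ↔ step τ m n ∧ z = p := by
  simp [CountdownAutomaton.game, automaton, h]

theorem rank_inl (m : M) (q : φ.State) :
    (ρ.game step val varRank).rank (m, .inl q) = ρ.rk q.1 :=
  (ρ.rk_eq_rank q.2.1).symm

/-- Every transition leads one step down in the syntactic tree or to a component of a tuple. -/
theorem inTuple_or_length_of_edge {m n : M} {q q' : φ.State}
    (h : (ρ.game step val varRank).edge (m, .inl q) (n, .inl q')) :
    φ.InTuple q'.1 ∨ q'.1.length = q.1.length + 1 := by
  have key : ∀ (k : ℕ) (hk : (φ.sub (q.1 ++ [k])).isSome),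
      Sum.inl q' = φ.locate (q.1 ++ [k]) hk → q'.1.length = q.1.length + 1 := by
    intro k hk hq
    simp [eq_of_locate_eq_inl hq.symm]
  obtain ⟨ψ, hψ⟩ := Option.isSome_iff_exists.1 q.2.1
  cases ψ with
  | var v =>
    rw [edge_of_delta_inl (delta_var hψ)] at h
    obtain ⟨-, t, ht, hq⟩ := h
    obtain ⟨w, n, η, α, i, x, θ, j, hw, rfl, -⟩ := valAt_of_target_eq_some (step := step) ht
    exact .inl ⟨w, n, η, α, i, x, θ, j, hw, eq_of_locate_eq_inl hq.symm⟩
  | top => exact absurd ((edge_of_delta_inl (delta_top hψ)).1 h).2 (Set.notMem_empty _)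
  | bot => exact absurd ((edge_of_delta_inl (delta_bot hψ)).1 h).2 (Set.notMem_empty _)
  | or ψ χ =>
    rw [edge_of_delta_inl (delta_or hψ)] at h
    rcases h.2 with h | h
    · exact .inr (key _ _ h)
    · exact .inr (key _ _ h)
  | and ψ χ =>
    rw [edge_of_delta_inl (delta_and hψ)] at h
    rcases h.2 with h | h
    · exact .inr (key _ _ h)
    · exact .inr (key _ _ h)
  | dia τ ψ => exact .inr (key _ _ ((edge_of_delta_inr (delta_dia hψ)).1 h).2)
  | box τ ψ => exact .inr (key _ _ ((edge_of_delta_inr (delta_box hψ)).1 h).2)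
  | fix η α i x θ =>
    rw [edge_of_delta_inl (delta_fix hψ)] at h
    exact .inr (key _ _ h.2)

/-! ### The invariant -/

variable (ρ step val) in
/-- `P` claims that, under the approximants given by `t`, the subformula of `φ` at the path `p`
holds at `m` (if `P` is Eve) or fails there (if `P` is Adam). -/
def ClaimsAt (P : Player) (t : R → Ordinal.{u}) (m : M) (p : List ℕ) : Prop :=
  ∀ ψ, φ.sub p = some ψ → P.Claims (m ∈ ψ.sem step (valAt step (ρ.index P t) φ p val))

variable (ρ step val) in
/-- The path `p` leads to a component of a tuple, and `P` claims that the current approximant of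
this tuple, given by `t`, holds or fails at `m`. -/
def ClaimsComponent (P : Player) (t : R → Ordinal.{u}) (m : M) (p : List ℕ) : Prop :=
  ∃ (w : List ℕ) (n : ℕ) (η : FixKind) (α : WithTop Ordinal.{u}) (i : Fin n) (x : Fin n → Var)
    (θ : Fin n → Formula.{u} Act Var) (j : Fin n),
    φ.sub w = some (.fix η α i x θ) ∧ p = w ++ [j.1] ∧
      P.Claims (m ∈ approx η (ρ.index P t w) (tupleMap x (fun j => (θ j).sem step)
        (valAt step (ρ.index P t) φ w val)) j)

variable (ρ step val varRank) in
/-- The invariant of the winning strategy of `P`: the memory `t` agrees with the counters, and the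
claim of `P` about the current position is true. -/
def Invariant (P : Player) (t : R → Ordinal.{u}) : (ρ.game step val varRank).Config → Prop
  | .positional (m, .inl q) ctr =>
    ρ.Linked P t ctr ∧ ρ.ClaimsAt step val P t m q.1 ∧ ρ.Fresh M t q.1
  | .positional (m, .inr x) _ => P.Claims (m ∈ val x)
  | .countdown (m, .inl q) ctr => ρ.Linked P t ctr ∧ (ρ.ClaimsComponent step val P t m q.1 ∨
      ¬ φ.InTuple q.1 ∧ ρ.ClaimsAt step val P t m q.1 ∧ ρ.Fresh M t q.1)
  | .countdown (m, .inr x) ctr => ρ.Linked P t ctr ∧ P.Claims (m ∈ val x)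

variable {P : Player} {t : R → Ordinal.{u}} {ctr : ρ.nonstd → Ordinal.{u}}

theorem claims_of_claimsAt_freeVar {m : M} {p : List ℕ} {v : Var} (hv : φ.freeVar p = some v)
    (h : ρ.ClaimsAt step val P t m p) : P.Claims (m ∈ val v) := by
  obtain ⟨hp, ht⟩ := freeVar_eq_some hv
  have h' := h _ hp
  change P.Claims (m ∈ valAt step (ρ.index P t) φ p val v) at h'
  rwa [valAt_of_target_eq_none ht] at h'

/-- Arrival at a subformula of an operator other than a fixpoint operator. -/
theorem invariant_child {m : M} {p : List ℕ} {k : ℕ} {ψ χ : Formula.{u} Act Var}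
    (hp : φ.sub p = some ψ) (hk : ψ.child k = some χ)
    (hψ : ∀ n η α (i : Fin n) x θ, ψ ≠ .fix η α i x θ) (hl : ρ.Linked P t ctr)
    (hf : ρ.Fresh M t p) (h : P.Claims (m ∈ χ.sem step (valAt step (ρ.index P t) φ p val)))
    (hs : (φ.sub (p ++ [k])).isSome) :
    ρ.Invariant step val varRank P t (.countdown (m, φ.locate (p ++ [k]) hs) ctr) := by
  have hnot : ¬ φ.InTuple (p ++ [k]) := by
    intro hT
    obtain ⟨n, η, α, i, x, θ, hw, -⟩ := inTuple_snoc hT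
    rw [hp] at hw
    exact hψ _ _ _ _ _ _ (Option.some.inj hw)
  have hsub : φ.sub (p ++ [k]) = some χ := by simp [sub_append, hp, sub, hk]
  have hbind : ∀ a (v : Var → Set M), ψ.bindVal step a v = v := by
    intro a v
    cases ψ with
    | fix η α i x θ => exact absurd rfl (hψ _ _ _ _ _ _)
    | _ => rfl
  have hclaim : ρ.ClaimsAt step val P t m (p ++ [k]) := by
    intro χ' hχ'
    obtain rfl : χ = χ' := Option.some.inj (hsub.symm.trans hχ')
    rwa [valAt_snoc hp (by simp [hk]), hbind]
  have hfresh : ρ.Fresh M t (p ++ [k]) := by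
    intro r hr
    exact hf r fun p' hp' hpre => hr p' hp' (hpre.trans (List.prefix_append _ _))
  cases hv : φ.freeVar (p ++ [k]) with
  | none =>
    rw [locate_of_freeVar_eq_none hv hs]
    exact ⟨hl, .inr ⟨hnot, hclaim, hfresh⟩⟩
  | some v =>
    rw [locate_of_freeVar_eq_some hv hs]
    exact ⟨hl, claims_of_claimsAt_freeVar hv hclaim⟩

/-- Arrival at a component of a tuple. If this component is a free variable then the approximant
in question is not the one with index zero, by the reserve in `Link`, and so the claim about it is
a claim about the value of the variable. -/
theorem invariant_component (hφ : φ.FreeComponentsInfinite) {m : M} {w : List ℕ} {n : ℕ}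
    {η : FixKind} {α : WithTop Ordinal.{u}} {i : Fin n} {x : Fin n → Var}
    {θ : Fin n → Formula.{u} Act Var} {j : Fin n} (hw : φ.sub w = some (.fix η α i x θ))
    (hl : ρ.Linked P t ctr) (h : P.Claims (m ∈ approx η (ρ.index P t w)
      (tupleMap x (fun j => (θ j).sem step) (valAt step (ρ.index P t) φ w val)) j))
    (hs : (φ.sub (w ++ [j.1])).isSome) :
    ρ.Invariant step val varRank P t (.countdown (m, φ.locate (w ++ [j.1]) hs) ctr) := by
  classical
  cases hv : φ.freeVar (w ++ [j.1]) with
  | none =>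
    rw [locate_of_freeVar_eq_none hv hs]
    exact ⟨hl, .inl ⟨w, n, η, α, i, x, θ, j, hw, rfl, h⟩⟩
  | some v =>
    rw [locate_of_freeVar_eq_some hv hs]
    refine ⟨hl, ?_⟩
    have key : ∀ a : WithTop Ordinal.{u}, P.Claims (m ∈ tupleMap x (fun j => (θ j).sem step)
        (valAt step (ρ.index P t) φ w val) (approx η a (tupleMap x (fun j => (θ j).sem step)
          (valAt step (ρ.index P t) φ w val))) j) → P.Claims (m ∈ val v) := by
      intro a ha
      have hA := tupleMap_approx_eq_sem (step := step) hw j (A := ρ.index P t)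
        (A' := Function.update (ρ.index P t) w a) val (by
          intro w' k _ _ _ _ _ _ hpre _ _
          rw [Function.update_of_ne]
          rintro rfl
          simpa using hpre.length_le)
      rw [Function.update_self] at hA
      rw [hA] at ha
      obtain ⟨hp, ht⟩ := freeVar_eq_some hv
      have hθ : θ j = .var v := Option.some.inj ((sub_component hw j).symm.trans hp)
      rw [hθ] at ha
      change P.Claims (m ∈ valAt step (Function.update (ρ.index P t) w a) φ (w ++ [j.1]) val v)
        at ha
      rwa [valAt_of_target_eq_none ht] at ha
    by_cases hown : η.owner = P
    · have hidx : ρ.index P t w = t (ρ.rk (w ++ [0])) :=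
        if_neg fun hc => hc.2 ((ρ.rankOwner_rk hw).trans hown)
      rw [hidx] at h
      obtain ⟨b, -, hb⟩ := exists_claims_of_claims_approx hown h
      exact key _ hb
    · induction α using WithTop.recTopCoe with
      | top =>
        have hidx : ρ.index P t w = ⊤ :=
          if_pos ⟨ρ.rk_notMem_nonstd hw, fun hc => hown ((ρ.rankOwner_rk hw).symm.trans hc)⟩
        rw [hidx, approx_top] at h
        exact key _ h
      | coe α =>
        obtain ⟨hn, hctr⟩ := ρ.rk_mem_nonstd hw
        have hidx : ρ.index P t w = t (ρ.rk (w ++ [0])) := if_neg fun hc => hc.1 hn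
        rw [hidx] at h
        have hω : Ordinal.omega0 ≤ α := hφ _ _ _ _ (isComponent_of_sub hw j) (by simp [hv])
        have hlink := hl ⟨_, hn⟩
        rw [Link, hctr, if_pos hω, if_neg fun hc => hown ((ρ.rankOwner_rk hw).symm.trans hc)]
          at hlink
        refine key _ (claims_of_claims_approx hown h (b := 0) ?_)
        rw [hlink]
        exact lt_of_lt_of_le zero_lt_one le_self_add

/-- In a positional configuration, `P` can maintain the invariant, and the opponent has to. -/
theorem invariant_positional (hφ : φ.FreeComponentsInfinite) {m : M} {q : φ.State}
    (h : ρ.Invariant step val varRank P t (.positional (m, .inl q) ctr)) :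
    ((ρ.game step val varRank).owner (m, .inl q) = P →
      ∃ v, (ρ.game step val varRank).edge (m, .inl q) v ∧
        ρ.Invariant step val varRank P t (.countdown v ctr)) ∧
    ((ρ.game step val varRank).owner (m, .inl q) ≠ P →
      ∀ v, (ρ.game step val varRank).edge (m, .inl q) v →
        ρ.Invariant step val varRank P t (.countdown v ctr)) := by
  obtain ⟨hl, hc, hf⟩ := h
  obtain ⟨ψ, hψ⟩ := Option.isSome_iff_exists.1 q.2.1
  replace hc := hc ψ hψ
  -- a state with a unique successor that maintains the invariant, whoever owns it
  have single : ∀ z : φ.State ⊕ Var, φ.delta q = .inl {z} →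
      ρ.Invariant step val varRank P t (.countdown (m, z) ctr) →
      ((ρ.game step val varRank).owner (m, .inl q) = P →
        ∃ v, (ρ.game step val varRank).edge (m, .inl q) v ∧
          ρ.Invariant step val varRank P t (.countdown v ctr)) ∧
      ((ρ.game step val varRank).owner (m, .inl q) ≠ P →
        ∀ v, (ρ.game step val varRank).edge (m, .inl q) v →
          ρ.Invariant step val varRank P t (.countdown v ctr)) := by
    intro z hz hinv
    refine ⟨fun _ => ⟨(m, z), (edge_of_delta_inl hz).2 ⟨rfl, rfl⟩, hinv⟩, ?_⟩
    rintro - ⟨n, z'⟩ he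
    obtain ⟨rfl, rfl⟩ := (edge_of_delta_inl hz).1 he
    exact hinv
  have owner : (ρ.game step val varRank).owner (m, .inl q) = φ.stateOwner ρ.otherOwner q := rfl
  cases ψ with
  | var v =>
    have hfree := q.2.2
    simp only [freeVar, hψ] at hfree
    cases ht : φ.target q.1 v with
    | none => simp [ht] at hfree
    | some p =>
      have hs := target_isSome ht
      refine single (φ.locate p hs) ?_ ?_
      · rw [delta_var hψ]
        congr 1
        ext z
        simp [ht]
      · obtain ⟨w, n, η, α, i, x, θ, j, hw, rfl, hv⟩ := valAt_of_target_eq_some (step := step) ht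
        refine invariant_component hφ hw hl ?_ hs
        rw [← hv]
        exact hc
  | top =>
    rw [owner, stateOwner, hψ]
    refine ⟨?_, fun _ ⟨n, z⟩ he => absurd ((edge_of_delta_inl (delta_top hψ)).1 he).2
      (Set.notMem_empty _)⟩
    rintro rfl
    exact absurd (Set.mem_univ m) hc
  | bot =>
    rw [owner, stateOwner, hψ]
    refine ⟨?_, fun _ ⟨n, z⟩ he => absurd ((edge_of_delta_inl (delta_bot hψ)).1 he).2
      (Set.notMem_empty _)⟩
    rintro rfl
    exact absurd hc (Set.notMem_empty m)
  | or ψ χ =>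
    rw [owner, stateOwner, hψ]
    have left := fun h => invariant_child (step := step) (val := val)
      (varRank := varRank) (m := m) (k := 0) hψ rfl
      (by simp) hl hf h (sub_child hψ rfl)
    have right := fun h => invariant_child (step := step) (val := val)
      (varRank := varRank) (m := m) (k := 1) hψ rfl
      (by simp) hl hf h (sub_child hψ rfl)
    cases P with
    | eve =>
      refine ⟨fun _ => ?_, fun hne => absurd rfl hne⟩
      rcases hc with hc | hc
      · exact ⟨_, (edge_of_delta_inl (delta_or hψ)).2 ⟨rfl, .inl rfl⟩, left hc⟩
      · exact ⟨_, (edge_of_delta_inl (delta_or hψ)).2 ⟨rfl, .inr rfl⟩, right hc⟩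
    | adam =>
      refine ⟨(by cases ·), ?_⟩
      rintro - ⟨n, z⟩ he
      obtain ⟨rfl, rfl | rfl⟩ := (edge_of_delta_inl (delta_or hψ)).1 he
      · exact left fun h => hc (.inl h)
      · exact right fun h => hc (.inr h)
  | and ψ χ =>
    rw [owner, stateOwner, hψ]
    have left := fun h => invariant_child (step := step) (val := val)
      (varRank := varRank) (m := m) (k := 0) hψ rfl
      (by simp) hl hf h (sub_child hψ rfl)
    have right := fun h => invariant_child (step := step) (val := val)
      (varRank := varRank) (m := m) (k := 1) hψ rfl
      (by simp) hl hf h (sub_child hψ rfl)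
    cases P with
    | eve =>
      refine ⟨(by cases ·), ?_⟩
      rintro - ⟨n, z⟩ he
      obtain ⟨rfl, rfl | rfl⟩ := (edge_of_delta_inl (delta_and hψ)).1 he
      · exact left hc.1
      · exact right hc.2
    | adam =>
      refine ⟨fun _ => ?_, fun hne => absurd rfl hne⟩
      rcases not_and_or.1 hc with hc | hc
      · exact ⟨_, (edge_of_delta_inl (delta_and hψ)).2 ⟨rfl, .inl rfl⟩, left hc⟩
      · exact ⟨_, (edge_of_delta_inl (delta_and hψ)).2 ⟨rfl, .inr rfl⟩, right hc⟩
  | dia τ ψ =>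
    rw [owner, stateOwner, hψ]
    have child := fun n h => invariant_child (step := step) (val := val)
      (varRank := varRank) (m := n) (k := 0) hψ rfl
      (by simp) hl hf h (sub_child hψ rfl)
    cases P with
    | eve =>
      refine ⟨fun _ => ?_, fun hne => absurd rfl hne⟩
      obtain ⟨n, hmn, hn⟩ := hc
      exact ⟨(n, _), (edge_of_delta_inr (delta_dia hψ)).2 ⟨hmn, rfl⟩, child n hn⟩
    | adam =>
      refine ⟨(by cases ·), ?_⟩
      rintro - ⟨n, z⟩ he
      obtain ⟨hmn, rfl⟩ := (edge_of_delta_inr (delta_dia hψ)).1 he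
      exact child n fun h => hc ⟨n, hmn, h⟩
  | box τ ψ =>
    rw [owner, stateOwner, hψ]
    have child := fun n h => invariant_child (step := step) (val := val)
      (varRank := varRank) (m := n) (k := 0) hψ rfl
      (by simp) hl hf h (sub_child hψ rfl)
    cases P with
    | eve =>
      refine ⟨(by cases ·), ?_⟩
      rintro - ⟨n, z⟩ he
      obtain ⟨hmn, rfl⟩ := (edge_of_delta_inr (delta_box hψ)).1 he
      exact child n (hc n hmn)
    | adam =>
      refine ⟨fun _ => ?_, fun hne => absurd rfl hne⟩
      obtain ⟨n, hn⟩ := not_forall.1 hc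
      obtain ⟨hmn, hn⟩ := Classical.not_imp.1 hn
      exact ⟨(n, _), (edge_of_delta_inr (delta_box hψ)).2 ⟨hmn, rfl⟩, child n hn⟩
  | fix η α i x θ =>
    refine single _ (delta_fix hψ) (invariant_component hφ hψ hl ?_ _)
    rw [ρ.approx_index_of_fresh hψ hf]
    exact hc

end Ranking
end Formula

namespace Formula

variable {Act Var : Type*} {φ : Formula.{u} Act Var}

namespace Ranking

variable {R : Type*} [LinearOrder R] [Finite R] [OrderBot R] {ρ : φ.Ranking R}
  {M : Type u} {step : Act → M → M → Prop} {val : Var → Set M} {varRank : M → Var → R}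
  {P : Player} {t : R → Ordinal.{u}} {ctr : ρ.nonstd → Ordinal.{u}}

open CountdownGame

/-! ### The strategy -/

open Classical in
/-- The counters after the owner of the rank `s` has chosen the value `c` for it. -/
noncomputable def updateCtr (ρ : φ.Ranking R) (ctr : ρ.nonstd → Ordinal.{u}) (s : R)
    (c : Ordinal.{u}) (r : ρ.nonstd) : Ordinal.{u} :=
  if (r : R) < s then ρ.ctrI r else if r = s then c else ctr r

theorem move_updateCtr {v : M × (φ.State ⊕ Var)} {c : Ordinal.{u}}
    (h : ∀ r : ρ.nonstd, r = (ρ.game step val varRank).rank v → c < ctr r) :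
    Move (G := ρ.game step val varRank) (.countdown v ctr)
      (.positional v (ρ.updateCtr ctr ((ρ.game step val varRank).rank v) c)) := by
  refine Move.countdown (G := ρ.game step val varRank) v ctr _
    (fun r hr => if_pos hr) (fun r hr => ?_) (fun r hr => ?_)
  · have hr' : ¬ (r : R) < (ρ.game step val varRank).rank v := hr.not_lt
    have he : ρ.updateCtr ctr ((ρ.game step val varRank).rank v) c r = c :=
      (if_neg hr').trans (if_pos hr)
    rw [he]
    exact h r hr
  · exact (if_neg hr.not_gt).trans (if_neg hr.ne')

/-- The positions whose ranks matter: the components of tuples. -/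
def AtComponent (v : M × (φ.State ⊕ Var)) : Prop := ∃ q, v.2 = .inl q ∧ φ.InTuple q.1

/-- Departure from a component of a tuple, after its operator has been unfolded. -/
theorem invariant_updateMem {m : M} {q : φ.State} {ctr' : ρ.nonstd → Ordinal.{u}}
    {w : List ℕ} {n : ℕ} {η : FixKind} {α : WithTop Ordinal.{u}} {i : Fin n} {x : Fin n → Var}
    {θ : Fin n → Formula.{u} Act Var} {j : Fin n} (hw : φ.sub w = some (.fix η α i x θ))
    (hq : q.1 = w ++ [j.1]) {b : Ordinal.{u}} (hl : ρ.Linked P t ctr)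
    (hc : P.Claims (m ∈ tupleMap x (fun j => (θ j).sem step)
      (valAt step (ρ.index P t) φ w val)
      (approx η (ρ.index P (ρ.updateMem M t (ρ.rk q.1) b) w)
        (tupleMap x (fun j => (θ j).sem step) (valAt step (ρ.index P t) φ w val))) j))
    (reset : ∀ r : ρ.nonstd, r < ρ.rk q.1 → ctr' r = ρ.ctrI r)
    (link : ∀ r : ρ.nonstd, r = ρ.rk q.1 → ρ.Link P r (ctr' r) b)
    (keep : ∀ r : ρ.nonstd, ρ.rk q.1 < r → ctr' r = ctr r) :
    ρ.Invariant step val varRank P (ρ.updateMem M t (ρ.rk q.1) b)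
      (.positional (m, .inl q) ctr') := by
  have hT : φ.InTuple q.1 := ⟨w, n, η, α, i, x, θ, j, hw, hq⟩
  refine ⟨ρ.linked_updateMem hl reset link keep, ?_, ?_⟩
  · intro ψ hψ
    rw [hq, sub_component hw j] at hψ
    obtain rfl := Option.some.inj hψ
    rw [tupleMap_approx_eq_sem (A' := ρ.index P (ρ.updateMem M t (ρ.rk q.1) b)) hw j val] at hc
    · rwa [← hq] at hc
    · intro w' k n' η' α' i' x' θ' hpre hw' hk
      refine ρ.index_congr ?_
      rw [ρ.updateMem_of_gt]
      rw [← ρ.rk_component hw' ⟨k, hk⟩]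
      refine ρ.rk_lt_rk hT ⟨w', n', η', α', i', x', θ', ⟨k, hk⟩, hw', rfl⟩ ?_ ?_
      · rw [hq]
        exact hpre.trans (List.prefix_append _ _)
      · rw [hq]
        intro he
        have := hpre.length_le
        simp only [he, List.length_append, List.length_singleton] at this
        omega
  · intro r hr
    exact ρ.updateMem_of_lt (hr _ hT List.prefix_rfl)

/-- In a countdown configuration, `P` can maintain the invariant, and the opponent has to. -/
theorem invariant_countdown
    (hvarRank : ∀ m x (h : varRank m x ∈ ρ.nonstd), Ordinal.omega0 ≤ ρ.ctrI ⟨varRank m x, h⟩)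
    {v : M × (φ.State ⊕ Var)} (h : ρ.Invariant step val varRank P t (.countdown v ctr)) :
    ((ρ.game step val varRank).rankOwner ((ρ.game step val varRank).rank v) = P →
      ∃ ctr' t', Move (G := ρ.game step val varRank) (.countdown v ctr) (.positional v ctr') ∧
        ρ.Invariant step val varRank P t' (.positional v ctr') ∧
        MemoryStep (G := ρ.game step val varRank) P AtComponent t (.countdown v ctr) t') ∧
    ((ρ.game step val varRank).rankOwner ((ρ.game step val varRank).rank v) ≠ P →
      ∀ ctr', Move (G := ρ.game step val varRank) (.countdown v ctr) (.positional v ctr') →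
        ∃ t', ρ.Invariant step val varRank P t' (.positional v ctr') ∧
          MemoryStep (G := ρ.game step val varRank) P AtComponent t (.countdown v ctr) t') := by
  obtain ⟨m, q | x⟩ := v
  · obtain ⟨hl, ⟨w, n, η, α, i, x, θ, j, hw, hq, hc⟩ | ⟨hT, hc, hf⟩⟩ := h
    · have hT : φ.InTuple q.1 := ⟨w, n, η, α, i, x, θ, j, hw, hq⟩
      have hs : ρ.rk q.1 = ρ.rk (w ++ [0]) := by rw [hq, ρ.rk_component hw]
      have hη : ρ.rankOwner (ρ.rk q.1) = η.owner := by rw [hs, ρ.rankOwner_rk hw]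
      have hstep : ∀ b, (ρ.rk q.1 ∉ ρ.nonstd → ρ.rankOwner (ρ.rk q.1) = P → b < t (ρ.rk q.1)) →
          MemoryStep (G := ρ.game step val varRank) P AtComponent t (.countdown (m, .inl q) ctr)
            (ρ.updateMem M t (ρ.rk q.1) b) := by
        intro b hb
        refine ⟨fun h => absurd ⟨q, rfl, hT⟩ h, fun r hr => ?_, fun _ hn ho => ?_⟩
        · rw [rank_inl] at hr
          exact ρ.updateMem_of_gt hr
        · rw [rank_inl] at hn ho ⊢
          rw [ρ.updateMem_self]
          exact hb hn ho
      rw [rank_inl]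
      constructor
      -- `P` unfolds the operator, and chooses a counter that corresponds to the new ordinal
      · intro hown
        have hidx : ∀ t : R → Ordinal.{u}, ρ.index P t w = t (ρ.rk q.1) := by
          intro t
          rw [hs]
          exact if_neg fun hc => hc.2 (hs ▸ hown)
        rw [hidx] at hc
        obtain ⟨b, hb, hc⟩ := exists_claims_of_claims_approx (hη.symm.trans hown) hc
        obtain ⟨c, hc1, hc2⟩ : ∃ c, (∀ r : ρ.nonstd, r = ρ.rk q.1 → c < ctr r) ∧
            ∀ r : ρ.nonstd, r = ρ.rk q.1 → ρ.Link P r c b := by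
          by_cases hn : ρ.rk q.1 ∈ ρ.nonstd
          · obtain ⟨c, h1, h2⟩ := ρ.exists_link_lt_of_own (r := ⟨_, hn⟩) hown (hl _) hb
            refine ⟨c, ?_, ?_⟩
            · rintro ⟨r, hr⟩ rfl
              exact h1
            · rintro ⟨r, hr⟩ rfl
              exact h2
          · exact ⟨0, fun r hr => absurd (hr ▸ r.2) hn, fun r hr => absurd (hr ▸ r.2) hn⟩
        have hmove := move_updateCtr (step := step) (val := val) (varRank := varRank)
          (v := (m, .inl q)) (c := c) (by rwa [rank_inl])
        rw [rank_inl] at hmove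
        refine ⟨_, _, hmove, invariant_updateMem (b := b) hw hq hl ?_ ?_ ?_ ?_,
          hstep b fun _ _ => hb⟩
        · rwa [hidx, ρ.updateMem_self]
        · exact fun r hr => if_pos hr
        · intro r hr
          have he : ρ.updateCtr ctr (ρ.rk q.1) c r = c := (if_neg hr.not_lt).trans (if_pos hr)
          rw [he]
          exact hc2 r hr
        · exact fun r hr => (if_neg hr.not_gt).trans (if_neg hr.ne')
      -- a counter chosen by the opponent determines the new ordinal; without a counter, the
      -- operator stays interpreted by its fixpoint
      · rintro hopp ctr' hmove
        cases hmove with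
        | countdown _ _ _ reset decrement keep =>
        rw [rank_inl] at reset decrement keep
        by_cases hn : ρ.rk q.1 ∈ ρ.nonstd
        · have hidx : ∀ t : R → Ordinal.{u}, ρ.index P t w = t (ρ.rk q.1) := by
            intro t
            rw [hs]
            exact if_neg fun hc => hc.1 (hs ▸ hn)
          obtain ⟨b, hb, hlink⟩ := ρ.exists_link_lt_of_opp (r := ⟨_, hn⟩) hopp (hl _)
            (decrement ⟨_, hn⟩ rfl)
          refine ⟨_, invariant_updateMem (b := b) hw hq hl ?_ reset ?_ keep,
            hstep b fun h _ => absurd hn h⟩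
          · rw [hidx] at hc
            rw [hidx, ρ.updateMem_self]
            exact claims_of_claims_approx (fun h => hopp (hη.trans h)) hc hb
          · rintro ⟨r, hr⟩ rfl
            exact hlink
        · have hidx : ∀ t : R → Ordinal.{u}, ρ.index P t w = ⊤ := by
            intro t
            refine if_pos ?_
            rw [← hs]
            exact ⟨hn, hopp⟩
          refine ⟨_, invariant_updateMem (b := t (ρ.rk q.1)) hw hq hl ?_ reset
            (fun r hr => absurd (hr ▸ r.2) hn) keep, hstep _ fun _ h => absurd h hopp⟩
          rwa [hidx, approx_top, ← hidx (ρ.updateMem M t (ρ.rk q.1) (t (ρ.rk q.1)))] at hc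
    -- away from tuples the rank is `⊥`, which is standard, and no counter changes
    · have hbot : ρ.rk q.1 = ⊥ := ρ.rk_eq_bot hT
      have hstep : MemoryStep (G := ρ.game step val varRank) P AtComponent t
          (.countdown (m, .inl q) ctr) t := by
        refine ⟨fun _ => rfl, fun _ _ => rfl, ?_⟩
        rintro ⟨q', hq', hT'⟩
        cases hq'
        exact absurd hT' hT
      constructor
      · intro _
        refine ⟨ctr, t, .countdown _ _ _ ?_ ?_ fun _ _ => rfl, ⟨hl, hc, hf⟩, hstep⟩
        · intro r hr
          rw [rank_inl, hbot] at hr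
          exact absurd hr not_lt_bot
        · intro r hr
          rw [rank_inl, hbot] at hr
          exact absurd (hr ▸ r.2) ρ.bot_standard
      · intro _ ctr' hmove
        cases hmove with
        | countdown _ _ _ reset decrement keep =>
        obtain rfl : ctr' = ctr := by
          funext r
          refine keep r ?_
          rw [rank_inl, hbot, bot_lt_iff_ne_bot]
          intro hr
          exact absurd (hr ▸ r.2) ρ.bot_standard
        exact ⟨t, ⟨hl, hc, hf⟩, hstep⟩
  · obtain ⟨hl, hc⟩ := h
    have hstep : MemoryStep (G := ρ.game step val varRank) P AtComponent t
        (.countdown (m, .inr x) ctr) t := by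
      refine ⟨fun _ => rfl, fun _ _ => rfl, ?_⟩
      rintro ⟨q', hq', -⟩
      cases hq'
    refine ⟨fun hown => ⟨_, t, move_updateCtr (c := 0) ?_, hc, hstep⟩,
      fun _ ctr' _ => ⟨t, hc, hstep⟩⟩
    -- the counters of `P` are positive if their initial values are infinite
    change ∀ r : ρ.nonstd, (r : R) = varRank m x → 0 < ctr r
    rintro ⟨r, hr⟩ rfl
    have hlink := hl ⟨_, hr⟩
    change ρ.rankOwner (varRank m x) = P at hown
    rw [Link, if_pos (hvarRank m x hr), if_pos hown] at hlink
    rw [hlink]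
    exact lt_of_lt_of_le zero_lt_one le_self_add

/-- An infinite play never reaches a variable. -/
theorem exists_eq_inl_of_moves {π : ℕ → (ρ.game step val varRank).Config}
    (hmove : ∀ n, Move (π n) (π (n + 1))) (n : ℕ) : ∃ q, (π n).position.2 = .inl q := by
  have positional : ∀ n m x ctr, π n ≠ .positional (m, .inr x) ctr := by
    intro n m x ctr hn
    have hm := hmove n
    rw [hn] at hm
    cases h' : π (n + 1) <;> rw [h'] at hm <;> cases hm
    rename_i h
    exact h
  rcases hn : π n with ⟨⟨m, q | x⟩, ctr⟩ | ⟨⟨m, q | x⟩, ctr⟩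
  · exact ⟨q, rfl⟩
  · exact absurd hn (positional _ _ _ _)
  · exact ⟨q, rfl⟩
  · have hm := hmove n
    rw [hn] at hm
    cases h' : π (n + 1) <;> rw [h'] at hm <;> cases hm
    exact absurd h' (positional _ _ _ _)

/-- An infinite play visits components of tuples again and again, since in between it moves down
the syntactic tree. -/
theorem frequently_atComponent {π : ℕ → (ρ.game step val varRank).Config}
    (hmove : ∀ n, Move (π n) (π (n + 1))) :
    ∃ᶠ n in Filter.atTop, ∃ v ctr, π n = .countdown v ctr ∧ AtComponent v := by
  choose q hq using exists_eq_inl_of_moves hmove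
  obtain ⟨B, hB⟩ : ∃ B, ∀ q : φ.State, q.1.length ≤ B := by
    obtain ⟨B, hB⟩ := (Set.finite_range fun q : φ.State => q.1.length).bddAbove
    exact ⟨B, fun q => hB ⟨q, rfl⟩⟩
  by_contra hcon
  rw [Filter.not_frequently] at hcon
  have hcd : ∀ n v ctr, π n = .countdown v ctr → q (n + 1) = q n := by
    intro n v ctr hn
    have hm := hmove n
    have h1 := hq n
    have h2 := hq (n + 1)
    rw [hn] at hm h1
    cases h' : π (n + 1) <;> rw [h'] at hm <;> cases hm
    rw [h'] at h2
    exact Sum.inl_injective (h2.symm.trans h1)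
  have hpos : ∀ᶠ n in Filter.atTop, ∀ v ctr, π n = .positional v ctr →
      (q (n + 1)).1.length = (q n).1.length + 1 := by
    refine ((Filter.tendsto_add_atTop_nat 1).eventually hcon).mono ?_
    intro n hC v ctr hn
    have hm := hmove n
    have h1 := hq n
    have h2 := hq (n + 1)
    rw [hn] at hm h1
    cases h' : π (n + 1) <;> rw [h'] at hm <;> cases hm
    rename_i v' he
    rw [h'] at h2 hC
    obtain ⟨m, z⟩ := v
    obtain ⟨m', z'⟩ := v'
    change z = .inl (q n) at h1
    change z' = .inl (q (n + 1)) at h2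
    subst h1 h2
    refine (inTuple_or_length_of_edge he).resolve_left fun hT => ?_
    exact hC ⟨_, _, rfl, _, rfl, hT⟩
  refine not_frequently_lt (f := fun n => B - (q n).1.length) (hpos.mono fun n hn => ?_) ?_
  · rcases hπ : π n with ⟨v, ctr⟩ | ⟨v, ctr⟩
    · have := hn v ctr hπ
      omega
    · rw [hcd n v ctr hπ]
  · refine Filter.frequently_atTop.2 fun N => ?_
    obtain ⟨K, hK⟩ := Filter.eventually_atTop.1 hpos
    have dec : ∀ n ≥ K, ∀ v ctr, π n = .positional v ctr →
        B - (q (n + 1)).1.length < B - (q n).1.length := by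
      intro n hn v ctr hπ
      have h1 := hK n hn v ctr hπ
      have h2 := hB (q (n + 1))
      omega
    rcases hπ : π (max N K) with ⟨v, ctr⟩ | ⟨v, ctr⟩
    · exact ⟨_, le_max_left _ _, dec _ (le_max_right _ _) v ctr hπ⟩
    · have hm := hmove (max N K)
      rw [hπ] at hm
      cases h' : π (max N K + 1) <;> rw [h'] at hm <;> cases hm
      exact ⟨_, (le_max_left _ _).trans (Nat.le_succ _),
        dec _ ((le_max_right _ _).trans (Nat.le_succ _)) _ _ h'⟩

/-- `P` wins from every configuration that satisfies the invariant. -/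
theorem wins_of_invariant (hφ : φ.FreeComponentsInfinite)
    (hvarRank : ∀ m x (h : varRank m x ∈ ρ.nonstd), Ordinal.omega0 ≤ ρ.ctrI ⟨varRank m x, h⟩)
    {γ : (ρ.game step val varRank).Config} (h : ρ.Invariant step val varRank P t γ) :
    Wins P γ := by
  -- a variable whose claim is true belongs to the opponent, who is stuck there
  have stuck : ∀ m x, P.Claims (m ∈ val x) →
      (ρ.game step val varRank).owner (m, .inr x) ≠ P := by
    intro m x hx
    cases P <;> simp_all [Player.Claims, CountdownAutomaton.game]
  refine CountdownGame.wins_of_invariant (Inv := ρ.Invariant step val varRank P)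
    (Step := MemoryStep P AtComponent) ?_ ?_ ?_ h
  · rintro t (⟨⟨m, q | x⟩, ctr⟩ | ⟨v, ctr⟩) hinv hturn
    · obtain ⟨v, he, hv⟩ := (invariant_positional hφ hinv).1 hturn
      exact ⟨_, t, .positional _ v _ he, hv, rfl⟩
    · exact absurd hturn (stuck m x hinv)
    · obtain ⟨ctr', t', h1, h2, h3⟩ := (invariant_countdown hvarRank hinv).1 hturn
      exact ⟨_, t', h1, h2, h3⟩
  · intro t γ γ' hinv hturn hmove
    cases hmove with
    | positional v w ctr he =>
      obtain ⟨m, q | x⟩ := v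
      · exact ⟨t, (invariant_positional hφ hinv).2 hturn w he, rfl⟩
      · exact he.elim
    | countdown v ctr ctr' h1 h2 h3 =>
      exact (invariant_countdown hvarRank hinv).2 hturn ctr' (.countdown v ctr ctr' h1 h2 h3)
  · intro π t hmove hstep
    refine winsInfinite_of_memoryStep hmove hstep (fun n hn => ?_) (frequently_atComponent hmove)
    obtain ⟨q, hq⟩ := exists_eq_inl_of_moves hmove n
    have hv : (π n).position = ((π n).position.1, .inl q) := Prod.ext rfl hq
    rw [hv, rank_inl]
    exact ρ.rk_eq_bot fun hT => hn ⟨q, hq, hT⟩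

/-- The player whose claim about `φ` is true wins the semantic game. -/
theorem wins_of_claims (hφ : φ.FreeComponentsInfinite)
    (hvarRank : ∀ m x (h : varRank m x ∈ ρ.nonstd), Ordinal.omega0 ≤ ρ.ctrI ⟨varRank m x, h⟩)
    {m : M} (h : P.Claims (m ∈ φ.sem step val)) :
    Wins (G := ρ.game step val varRank) P (.positional (m, (φ.automaton ρ).init) ρ.ctrI) := by
  have hclaim : ρ.ClaimsAt step val P (ρ.initMem M) m [] := by
    intro ψ hψ
    obtain rfl : φ = ψ := by simpa [sub] using hψ
    exact h
  refine wins_of_invariant (t := ρ.initMem M) hφ hvarRank ?_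
  have hs : (φ.sub []).isSome := rfl
  change ρ.Invariant step val varRank P _ (.positional (m, φ.locate [] hs) ρ.ctrI)
  cases hv : φ.freeVar [] with
  | none =>
    rw [locate_of_freeVar_eq_none hv]
    exact ⟨ρ.linked_initMem P M, hclaim, fun _ _ => rfl⟩
  | some v =>
    rw [locate_of_freeVar_eq_some hv]
    exact claims_of_claimsAt_freeVar hv hclaim

end Ranking
end Formula
end CountdownMu

open CountdownMu
theorem mainTheorem1 {Act Var : Type*} (φ : Formula.{u} Act Var)
    (hφ : φ.FreeComponentsInfinite)
    {R : Type*} [LinearOrder R] [Finite R] [OrderBot R] (ρ : φ.Ranking R)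
    {M : Type u} (step : Act → M → M → Prop) (val : Var → Set M)
    (varRank : M → Var → R)
    (hvarRank : ∀ m x (h : varRank m x ∈ ρ.nonstd), Ordinal.omega0 ≤ ρ.ctrI ⟨varRank m x, h⟩) :
    φ.sem step val = (φ.automaton ρ).language step val varRank ∧
    ∀ m : M,
      CountdownGame.Wins (G := (φ.automaton ρ).game step val varRank) .eve
          (.positional (m, (φ.automaton ρ).init) (φ.automaton ρ).ctrI) ↔
        m ∈ φ.sem step val := by
  have key : ∀ m : M,
      CountdownGame.Wins (G := (φ.automaton ρ).game step val varRank) .eve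
          (.positional (m, (φ.automaton ρ).init) (φ.automaton ρ).ctrI) ↔
        m ∈ φ.sem step val := by
    intro m
    refine ⟨fun he => ?_, fun h => Formula.Ranking.wins_of_claims (P := .eve) hφ hvarRank h⟩
    by_contra h
    exact CountdownGame.not_wins_adam_of_wins_eve he
      (Formula.Ranking.wins_of_claims (P := .adam) hφ hvarRank h)
  exact ⟨Set.ext fun m => (key m).symm, key⟩
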